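/- Let $m>0$ and $c>0$ be real. Let $\Theta(m,c)=\{\theta\in\ell_2:\sum_{j\ge1}j^{2m}\theta_j^2\le c^2/\pi^{2m}\}$ be the Sobolev ellipsoid. For $\varepsilon>0$ and $\theta\in\Theta(m,c)$ one observes independent $Y_j\sim\mathcal N(\theta_j,\varepsilon^2)$, $j=1,2,\dots$. For real $b\ge0$, an estimator $\widehat\theta$ uses at most $b$ bits, written $C(\widehat\theta)\le b$, if $\widehat\theta=\psi\circ\phi$ for a measurable encoder $\phi$ mapping the data $Y$ into an index set with at most $2^{b}$ elements and a decoder $\psi$ mapping indices to real sequences. Let \[ R_\varepsilon(m,c,b)=\inf_{\widehat\theta:\,C(\widehat\theta)\le b}\ \sup_{\theta\in\Theta(m,c)}\mathbb E_\theta\|\theta-\widehat\theta(Y)\|_2^2 . \] Let \[ \mathsf P_{m,c}=\Big(\frac{c^2(2m+1)}{\pi^{2m}}\Big)^{\frac1{2m+1}}\Big(\frac m{m+1}\Big)^{\frac{2m}{2m+1}} \] be Pinsker's constant. For $d\ge0$ let $\mathsf V_{m,c,d}\in[0,\infty]$ be the supremum of \[ \int_0^{x_0}\frac{\sigma^2(x)}{\sigma^2(x)+1}\,dx+x_0\,\alpha,\qquad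 \alpha=\exp\Big(\frac1{x_0}\int_0^{x_0}\log\frac{\sigma^4(x)}{\sigma^2(x)+1}\,dx-\frac{2d}{x_0}\Big), \] over all $x_0>0$ and all decreasing (i.e. non-increasing) functions $\sigma^2:(0,x_0]\to[0,\infty)$ such that $\log\frac{\sigma^4}{\sigma^2+1}$ is integrable on $(0,x_0]$, \[ \int_0^{x_0}x^{2m}\sigma^2(x)\,dx\le\frac{c^2}{\pi^{2m}}\qquad\text{and}\qquad \frac{\sigma^4(x)}{\sigma^2(x)+1}\ge\alpha\ \text{ for all }0<x\le x_0 . \] Let $\mathsf Q_{m,c,d}=\max(\mathsf V_{m,c,d}-\mathsf P_{m,c},0)$. Let $B_\varepsilon\ge0$ be a real bit budget for each $\varepsilon>0$. As $\varepsilon\to0^+$: (i) If $B_\varepsilon\varepsilon^{\frac2{2m+1}}\to\infty$, then $\liminf_{\varepsilon\to0}\varepsilon^{-\frac{4m}{2m+1}}R_\varepsilon(m,c,B_\varepsilon)\ge\mathsf P_{m,c}$. (ii) If $B_\varepsilon\varepsilon^{\frac2{2m+1}}\to d$ for some constant $d$, then $\liminf_{\varepsilon\to0}\varepsilon^{-\frac{4m}{2m+1}}R_\varepsilon(m,c,B_\varepsilon)\ge\mathsf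 P_{m,c}+\mathsf Q_{m,c,d}=\mathsf V_{m,c,d}$. (iii) If $B_\varepsilon\varepsilon^{\frac2{2m+1}}\to0$ and $B_\varepsilon\to\infty$, then $\liminf_{\varepsilon\to0}B_\varepsilon^{2m}R_\varepsilon(m,c,B_\varepsilon)\ge\dfrac{c^2m^{2m}}{\pi^{2m}}$. -/

import Mathlib

open Filter Topology MeasureTheory ProbabilityTheory
open scoped ENNReal NNReal

namespace QuantizedSobolev

noncomputable section

/-- The ellipsoid weights `a_j = j ^ m`, `j = 1, 2, …`.  Sequences are indexed by `ℕ`, the index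
`j : ℕ` standing for the coordinate number `j + 1`. -/
def weight (m : ℝ) (j : ℕ) : ℝ := ((j : ℝ) + 1) ^ m

/-- The Sobolev ellipsoid `Θ(m, c)`: the `θ ∈ ℓ₂` with `∑ a_j² θ_j² ≤ c² / π^{2m}`. -/
def sobolevEllipsoid (m c : ℝ) : Set (ℕ → ℝ) :=
  {θ | Memℓp θ 2 ∧ Summable (fun j => weight m j ^ 2 * θ j ^ 2) ∧
    ∑' j, weight m j ^ 2 * θ j ^ 2 ≤ c ^ 2 / Real.pi ^ (2 * m)}

/-- The law of the data `Y = (Y_j)` of the Gaussian sequence model with mean `θ` and noise level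
`ε`: the `Y_j ∼ N(θ_j, ε²)` are independent. -/
def dataLaw (θ : ℕ → ℝ) (ε : ℝ) : Measure (ℕ → ℝ) :=
  Measure.infinitePi fun j => gaussianReal (θ j) (Real.toNNReal (ε ^ 2))

/-- The squared `ℓ₂` distance `∑ (θ_j - η_j)²`, with value `∞` when the series diverges. -/
def sqDist (θ η : ℕ → ℝ) : ℝ≥0∞ := ∑' j, ENNReal.ofReal ((θ j - η j) ^ 2)

/-- `T` is a quantized estimator that uses at most `b` bits: it is the composition `ψ ∘ φ` of a
measurable encoder `φ` of the data into an index set of at most `2 ^ b` elements and a decoder `ψ`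
into sequences. -/
def UsesAtMostBits (b : ℝ) (T : (ℕ → ℝ) → (ℕ → ℝ)) : Prop :=
  ∃ N : ℕ, (N : ℝ) ≤ (2 : ℝ) ^ b ∧
    ∃ (φ : (ℕ → ℝ) → Fin N) (ψ : Fin N → (ℕ → ℝ)), Measurable φ ∧ T = ψ ∘ φ

/-- The risk `E_θ ‖θ - T(Y)‖²`. -/
def risk (ε : ℝ) (T : (ℕ → ℝ) → (ℕ → ℝ)) (θ : ℕ → ℝ) : ℝ≥0∞ :=
  ∫⁻ y, sqDist θ (T y) ∂(dataLaw θ ε)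

/-- The quantized minimax risk `R_ε(m, c, b)`. -/
def minimaxRisk (m c ε b : ℝ) : ℝ≥0∞ :=
  ⨅ (T : (ℕ → ℝ) → (ℕ → ℝ)) (_ : UsesAtMostBits b T), ⨆ θ ∈ sobolevEllipsoid m c, risk ε T θ

/-- Pinsker's constant `P_{m,c}`. -/
def pinskerConst (m c : ℝ) : ℝ :=
  (c ^ 2 * (2 * m + 1) / Real.pi ^ (2 * m)) ^ (1 / (2 * m + 1)) *
    (m / (m + 1)) ^ (2 * m / (2 * m + 1))

/-- `σ⁴ / (σ² + 1)` as a function of `s = σ²`. -/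
def gain (s : ℝ) : ℝ := s ^ 2 / (s + 1)

/-- The level `exp ((1/x₀) ∫₀^{x₀} log (σ⁴/(σ²+1)) dx - 2d/x₀)`; `s` is the function `σ²`. -/
def waterLevel (d : ℝ) (s : ℝ → ℝ) (x₀ : ℝ) : ℝ :=
  Real.exp (1 / x₀ * (∫ x in (0 : ℝ)..x₀, Real.log (gain (s x))) - 2 * d / x₀)

/-- The feasible set `F(m, c, d)` of the variational problem: the pairs of a decreasing
nonnegative function `s = σ²` on `(0, x₀]` and a number `x₀ > 0` that satisfy the two constraints.
The last constraint forces `σ² > 0` on `(0, x₀]`; the function may be unbounded near `0`. -/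
structure Feasible (m c d : ℝ) (s : ℝ → ℝ) (x₀ : ℝ) : Prop where
  pos : 0 < x₀
  nonneg : ∀ x ∈ Set.Ioc 0 x₀, 0 ≤ s x
  decreasing : AntitoneOn s (Set.Ioc 0 x₀)
  energy_integrable : IntervalIntegrable (fun x => x ^ (2 * m) * s x) volume 0 x₀
  energy_le : ∫ x in (0 : ℝ)..x₀, x ^ (2 * m) * s x ≤ c ^ 2 / Real.pi ^ (2 * m)
  log_integrable : IntervalIntegrable (fun x => Real.log (gain (s x))) volume 0 x₀
  level_le : ∀ x ∈ Set.Ioc 0 x₀, waterLevel d s x₀ ≤ gain (s x)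

/-- The objective of the variational problem. -/
def objective (d : ℝ) (s : ℝ → ℝ) (x₀ : ℝ) : ℝ :=
  (∫ x in (0 : ℝ)..x₀, s x / (s x + 1)) + x₀ * waterLevel d s x₀

/-- The value `V_{m,c,d}` of the variational problem, in `[0, ∞]`. -/
def variationalValue (m c d : ℝ) : ℝ≥0∞ :=
  ⨆ (s : ℝ → ℝ) (x₀ : ℝ) (_ : Feasible m c d s x₀), ENNReal.ofReal (objective d s x₀)

/-- The constant `Q_{m,c,d}`, the excess of `V_{m,c,d}` over Pinsker's constant.  The subtraction
of `ℝ≥0∞` truncates at `0`, so the identity `P + Q = V` contains the inequality `P ≤ V`. -/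
def quantConst (m c d : ℝ) : ℝ≥0∞ :=
  variationalValue m c d - ENNReal.ofReal (pinskerConst m c)

end

end QuantizedSobolev

/-! The minimax risk is bounded below by the Bayes risk of a Gaussian prior whose variances follow a
profile `s = σ²` on a grid: coordinate number `k` gets variance close to `h ^ (2m+1) * s (k h)`. The
energy of the prior is then a Riemann sum for `∫ x ^ (2m) s`.

Under such a prior each `θ_j` is its posterior mean plus an error independent of all the data. The
error costs the posterior variance, whatever the estimator. The posterior means are independent
Gaussians, and describing them with `N` codewords costs at least the Shannon bound
`gaussian_quantization_bound`. The sum of the two costs is `bayes_risk_bound`. The prior can leave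
the ellipsoid. Its mean energy is kept a factor `1 - δ` below the limit and the decoder is
truncated, so the loss outside is dominated by the variance of the energy, of smaller order as `h →
0` (`minimaxRisk_ge`). Riemann sums then give `eventually_minimaxRisk_ge`, from which all three
regimes follow.

Pinsker's bound takes his profile, mesh `h = ε ^ (2/(2m+1))`, and drops the quantization term. A
constant budget ratio `d` uses the same mesh and an arbitrary feasible profile; the supremum over
profiles is `V`. At low rate the mesh is `1 / B`, the noise is negligible on that scale, and `s` is
proportional to `x ^ (-2m)` on nearly all of `(0, 1/m]`.

The identity `P + Q = V` amounts to `P ≤ V`. For `d = 0` a constant profile attains `P`. For `d > 0`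
Pinsker's profile is followed up to a point `t`, and its tail is replaced by a block of height
`σ²(t)` and equal mass. The point `t` makes the water level equal to the gain at `σ²(t)`; the block
uses no more energy than the tail and the objective does not fall below `P`. -/

namespace QuantizedSobolev

noncomputable section

/-! ### White noise, its moments and its rotation invariance -/

/-- Zipping two independent infinite product measures gives the infinite product of the pairs. -/
theorem map_zip_infinitePi {ι α β : Type*} [MeasurableSpace α] [MeasurableSpace β]
    (μ : ι → Measure α) (ν : ι → Measure β)
    [∀ i, IsProbabilityMeasure (μ i)] [∀ i, IsProbabilityMeasure (ν i)] :
    ((Measure.infinitePi μ).prod (Measure.infinitePi ν)).map (fun p i => (p.1 i, p.2 i)) =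
      Measure.infinitePi fun i => (μ i).prod (ν i) := by
  refine Measure.eq_infinitePi _ fun s t ht => ?_
  have hpre : (fun (p : (ι → α) × (ι → β)) i => (p.1 i, p.2 i)) ⁻¹' ((s : Set ι).pi t) =
      (Prod.map s.restrict s.restrict) ⁻¹'
        ((MeasurableEquiv.arrowProdEquivProdArrow α β s).symm ⁻¹'
          Set.univ.pi fun i : s => t i) := by
    ext p
    simp [Set.mem_pi, MeasurableEquiv.arrowProdEquivProdArrow, Equiv.arrowProdEquivProdArrow]
  have hbox : MeasurableSet (Set.univ.pi fun i : s => t i) := .univ_pi fun i => ht i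
  rw [Measure.map_apply (by fun_prop) (.pi s.countable_toSet fun _ _ => ht _), hpre,
    ← Measure.map_apply (by fun_prop)
      ((MeasurableEquiv.arrowProdEquivProdArrow α β s).symm.measurable hbox),
    ← Measure.map_prod_map _ _ (by fun_prop) (by fun_prop),
    Measure.infinitePi_map_restrict, Measure.infinitePi_map_restrict,
    ← Measure.map_apply (MeasurableEquiv.measurable _) hbox,
    ((measurePreserving_arrowProdEquivProdArrow α β s (fun i => μ i) (fun i => ν i)).symm).map_eq,
    Measure.pi_pi, Finset.prod_coe_sort s fun i => ((μ i).prod (ν i)) (t i)]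

/-- The law of a sequence of independent standard Gaussian variables. -/
def whiteNoise : Measure (ℕ → ℝ) := Measure.infinitePi fun _ => gaussianReal 0 1

instance : IsProbabilityMeasure whiteNoise := by unfold whiteNoise; infer_instance

theorem dataLaw_eq_map (θ : ℕ → ℝ) (ε : ℝ) :
    dataLaw θ ε = whiteNoise.map fun z j => θ j + ε * z j := by
  rw [whiteNoise, Measure.infinitePi_map_pi (f := fun j x => θ j + ε * x) _ (by fun_prop), dataLaw]
  congr 1
  funext j
  have : (fun x : ℝ => θ j + ε * x) = (fun x => θ j + x) ∘ fun x => ε * x := rfl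
  rw [this, ← Measure.map_map (by fun_prop) (by fun_prop), gaussianReal_map_const_mul,
    gaussianReal_map_const_add]
  congr 1
  · simp
  · ext; simp [sq_nonneg]

/-- Two independent white noises are invariant under rotations in each coordinate. -/
theorem map_rotation_whiteNoise (t : ℕ → ℝ) :
    (whiteNoise.prod whiteNoise).map (fun p =>
      ((fun j => Real.cos (t j) * p.1 j + Real.sin (t j) * p.2 j),
        (fun j => -Real.sin (t j) * p.1 j + Real.cos (t j) * p.2 j))) =
      whiteNoise.prod whiteNoise := by
  set γ : Measure ℝ := gaussianReal 0 1
  have hrot (a : ℝ) : (γ.prod γ).map (fun q : ℝ × ℝ =>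
      (Real.cos a * q.1 + Real.sin a * q.2, -Real.sin a * q.1 + Real.cos a * q.2)) = γ.prod γ := by
    have h := IsGaussian.map_rotation_eq_self_of_forall_strongDual_eq_zero (μ := γ) (fun L => by
      rw [integral_continuousLinearMap_gaussianReal, map_zero]) a
    convert h using 2
    ext q <;> simp [ContinuousLinearMap.rotation_apply]
  have hzip := map_zip_infinitePi (fun _ : ℕ => γ) (fun _ : ℕ => γ)
  have hinj : Function.LeftInverse (fun f : ℕ → ℝ × ℝ => ((fun j => (f j).1), fun j => (f j).2))
      (fun (p : (ℕ → ℝ) × (ℕ → ℝ)) i => (p.1 i, p.2 i)) := fun p => rfl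
  -- Zipping has the measurable left inverse of `hinj`, so it suffices to compare the zipped laws;
  -- these are products of planar Gaussians, each invariant under its own rotation.
  have key : ((whiteNoise.prod whiteNoise).map (fun p =>
      ((fun j => Real.cos (t j) * p.1 j + Real.sin (t j) * p.2 j),
        (fun j => -Real.sin (t j) * p.1 j + Real.cos (t j) * p.2 j)))).map
        (fun (p : (ℕ → ℝ) × (ℕ → ℝ)) i => (p.1 i, p.2 i)) =
      (whiteNoise.prod whiteNoise).map (fun (p : (ℕ → ℝ) × (ℕ → ℝ)) i => (p.1 i, p.2 i)) := by
    rw [Measure.map_map (by fun_prop) (by fun_prop)]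
    have := Measure.infinitePi_map_pi (fun _ : ℕ => γ.prod γ) (f := fun j q =>
      (Real.cos (t j) * q.1 + Real.sin (t j) * q.2, -Real.sin (t j) * q.1 + Real.cos (t j) * q.2))
      (by fun_prop)
    simp only [hrot] at this
    unfold whiteNoise
    rw [hzip]
    conv_rhs => rw [← this, ← hzip]
    rw [Measure.map_map (by fun_prop) (by fun_prop)]
    rfl
  have hid (ρ : Measure ((ℕ → ℝ) × (ℕ → ℝ))) :
      (ρ.map (fun (p : (ℕ → ℝ) × (ℕ → ℝ)) i => (p.1 i, p.2 i))).map
        (fun f : ℕ → ℝ × ℝ => ((fun j => (f j).1), fun j => (f j).2)) = ρ := by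
    rw [Measure.map_map (by fun_prop) (by fun_prop), hinj.comp_eq_id, Measure.map_id]
  rw [← hid (Measure.map _ _), key, hid]

theorem measurePreserving_eval_whiteNoise (j : ℕ) :
    MeasurePreserving (fun u : ℕ → ℝ => u j) whiteNoise (gaussianReal 0 1) :=
  measurePreserving_eval_infinitePi _ j

theorem memLp_eval_whiteNoise (j : ℕ) (p : ℝ≥0) :
    MemLp (fun u : ℕ → ℝ => u j) p whiteNoise :=
  (memLp_id_gaussianReal p).comp_measurePreserving (measurePreserving_eval_whiteNoise j)

theorem integral_eval_whiteNoise (j : ℕ) : ∫ u, u j ∂whiteNoise = 0 := by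
  rw [← integral_id_gaussianReal (μ := 0) (v := 1),
    ← (measurePreserving_eval_whiteNoise j).map_eq, integral_map (measurable_pi_apply j).aemeasurable (by fun_prop)]

theorem integral_sq_gaussianReal : ∫ x, x ^ 2 ∂gaussianReal 0 1 = 1 := by
  have h := variance_fun_id_gaussianReal (μ := 0) (v := 1)
  rw [variance_of_integral_eq_zero (by fun_prop) integral_id_gaussianReal] at h
  simpa using h

theorem integral_sq_eval_whiteNoise (j : ℕ) : ∫ u, u j ^ 2 ∂whiteNoise = 1 := by
  rw [← integral_sq_gaussianReal, ← (measurePreserving_eval_whiteNoise j).map_eq,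
    integral_map (measurable_pi_apply j).aemeasurable (by fun_prop)]

/-! ### Shannon lower bound for Gaussian vectors -/

/-- The logarithm of the density of `N(a / r, D / r ^ 2)` with respect to `N(0, 1)`. -/
def logDensity (r D a u : ℝ) : ℝ :=
  1 / 2 * Real.log (r ^ 2 / D) + u ^ 2 / 2 - (r * u - a) ^ 2 / (2 * D)

theorem measurable_logDensity (r D a : ℝ) : Measurable (logDensity r D a) := by
  unfold logDensity; fun_prop

theorem lintegral_exp_logDensity {r D : ℝ} (hr : 0 < r) (hD : 0 < D) (a : ℝ) :
    ∫⁻ u, ENNReal.ofReal (Real.exp (logDensity r D a u)) ∂gaussianReal 0 1 = 1 := by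
  have hv : (D / r ^ 2).toNNReal ≠ 0 := by
    simp only [ne_eq, Real.toNNReal_eq_zero, not_le]; positivity
  rw [gaussianReal_of_var_ne_zero 0 one_ne_zero,
    lintegral_withDensity_eq_lintegral_mul _ (measurable_gaussianPDF 0 1)
      (by have := measurable_logDensity r D a; fun_prop),
    ← lintegral_gaussianPDF_eq_one (a / r) hv]
  refine lintegral_congr fun u => ?_
  rw [Pi.mul_apply, gaussianPDF, gaussianPDF, ← ENNReal.ofReal_mul (gaussianPDFReal_nonneg _ _ _)]
  congr 1
  rw [gaussianPDFReal, gaussianPDFReal, logDensity, Real.coe_toNNReal _ (by positivity)]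
  have h1 : Real.exp (1 / 2 * Real.log (r ^ 2 / D)) = r / √D := by
    rw [one_div, inv_mul_eq_div, ← Real.log_sqrt (by positivity), Real.exp_log (by positivity),
      Real.sqrt_div' _ hD.le, Real.sqrt_sq hr.le]
  rw [add_sub_assoc, Real.exp_add, h1, sub_eq_add_neg (u ^ 2 / 2)]
  have h2 : √(2 * Real.pi * (D / r ^ 2)) = √(2 * Real.pi * (1 : ℝ≥0)) * √D / r := by
    rw [← mul_div_assoc, Real.sqrt_div' _ (by positivity), Real.sqrt_sq hr.le,
      Real.sqrt_mul (by positivity)]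
    simp
  rw [h2]
  have h3 : -(u - a / r) ^ 2 / (2 * (D / r ^ 2)) =
      -(u - 0) ^ 2 / (2 * ((1 : ℝ≥0) : ℝ)) + (u ^ 2 / 2 + -((r * u - a) ^ 2 / (2 * D))) := by
    push_cast
    field_simp
    ring
  rw [h3, Real.exp_add (-(u - 0) ^ 2 / _)]
  have : 0 < √(2 * Real.pi * (1 : ℝ≥0)) := by
    apply Real.sqrt_pos.2; simp [Real.pi_pos]
  generalize Real.exp (u ^ 2 / 2 + -((r * u - a) ^ 2 / (2 * D))) = e₁
  generalize Real.exp (-(u - 0) ^ 2 / (2 * ((1 : ℝ≥0) : ℝ))) = e₂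
  field_simp

/-- For a fixed codeword `a` the exponential is a product of density ratios in independent
coordinates. The common `D` plays the role of the distortion of a Gaussian test channel. -/
theorem lintegral_exp_sum_logDensity (I : Finset ℕ) {r : ℕ → ℝ} (hr : ∀ j ∈ I, 0 < r j) {D : ℝ}
    (hD : 0 < D) (a : ℕ → ℝ) :
    ∫⁻ u, ENNReal.ofReal (Real.exp (∑ j ∈ I, logDensity (r j) D (a j) (u j))) ∂whiteNoise = 1 := by
  have hmeas (j : ℕ) : Measurable fun x : ℝ =>
      ENNReal.ofReal (Real.exp (logDensity (r j) D (a j) x)) := by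
    have := measurable_logDensity (r j) D (a j); fun_prop
  have hind : iIndepFun (fun (j : ℕ) (u : ℕ → ℝ) =>
      ENNReal.ofReal (Real.exp (logDensity (r j) D (a j) (u j)))) whiteNoise :=
    iIndepFun_infinitePi (P := fun _ => gaussianReal 0 1) hmeas
  have h := lintegral_prod_eq_prod_lintegral_of_indepFun I _ hind
    fun j => (hmeas j).comp (measurable_pi_apply j)
  simp only [Real.exp_sum, ENNReal.ofReal_prod_of_nonneg fun _ _ => (Real.exp_pos _).le]
  rw [h]
  refine Finset.prod_eq_one fun j hj => ?_
  rw [← lintegral_exp_logDensity (hr j hj) hD (a j),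
    ← (measurePreserving_eval_whiteNoise j).map_eq,
    lintegral_map (hmeas j) (measurable_pi_apply j)]

theorem memLp_codeword {Ω : Type*} [MeasurableSpace Ω] {P : Measure Ω} [IsFiniteMeasure P] {N : ℕ}
    {k : Ω → Fin N} (hk : Measurable k) (a : Fin N → ℝ) (p : ℝ≥0∞) :
    MemLp (fun ω => a (k ω)) p P := by
  refine MemLp.of_bound ((measurable_of_finite a).comp hk).aestronglyMeasurable (∑ i, |a i|) ?_
  exact ae_of_all _ fun ω =>
    Finset.single_le_sum (f := fun i => |a i|) (fun i _ => abs_nonneg _) (Finset.mem_univ (k ω))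

/-- A Shannon lower bound for the quantization of a Gaussian vector with independent coordinates of
variance `r j ^ 2`, in a form that depends on a trial distortion `D`. -/
theorem gaussian_quantization_bound_trial (I : Finset ℕ) {r : ℕ → ℝ} (hr : ∀ j ∈ I, 0 < r j)
    {D : ℝ} (hD : 0 < D) {N : ℕ} {k : (ℕ → ℝ) → Fin N} (hk : Measurable k)
    (a : Fin N → ℕ → ℝ) :
    D * (I.card + ∑ j ∈ I, Real.log (r j ^ 2) - I.card * Real.log D - 2 * Real.log N) ≤
      ∫ u, ∑ j ∈ I, (r j * u j - a (k u) j) ^ 2 ∂whiteNoise := by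
  have hN : 0 < N := (k 0).pos
  have hN' : (0 : ℝ) < N := by exact_mod_cast hN
  have hint (j : ℕ) : Integrable (fun u : ℕ → ℝ => (r j * u j - a (k u) j) ^ 2) whiteNoise :=
    (((memLp_eval_whiteNoise j 2).const_mul (r j)).sub
      (memLp_codeword hk (fun i => a i j) 2)).integrable_sq
  have hsq (j : ℕ) : Integrable (fun u : ℕ → ℝ => u j ^ 2) whiteNoise :=
    (memLp_eval_whiteNoise j 2).integrable_sq
  have hld (j : ℕ) : Integrable (fun u : ℕ → ℝ => logDensity (r j) D (a (k u) j) (u j))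
      whiteNoise :=
    ((integrable_const _).add ((hsq j).div_const 2)).sub ((hint j).div_const (2 * D))
  set f : (ℕ → ℝ) → ℝ := fun u => ∑ j ∈ I, logDensity (r j) D (a (k u) j) (u j) with hf
  have hfi : Integrable f whiteNoise := integrable_finsetSum _ fun j _ => hld j
  -- The ratio at the chosen codeword is at most the sum of the ratios at all codewords, each of
  -- integral one. This replaces mutual information: no entropy is needed.
  have hexp : ∫⁻ u, ENNReal.ofReal (Real.exp (f u)) ∂whiteNoise ≤ N := by
    calc ∫⁻ u, ENNReal.ofReal (Real.exp (f u)) ∂whiteNoise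
        ≤ ∫⁻ u, ∑ i : Fin N, ENNReal.ofReal
            (Real.exp (∑ j ∈ I, logDensity (r j) D (a i j) (u j))) ∂whiteNoise := by
          refine lintegral_mono fun u => ?_
          exact Finset.single_le_sum (f := fun i : Fin N => ENNReal.ofReal
            (Real.exp (∑ j ∈ I, logDensity (r j) D (a i j) (u j)))) (fun _ _ => zero_le)
            (Finset.mem_univ (k u))
      _ = N := by
          rw [lintegral_finsetSum]
          · simp [lintegral_exp_sum_logDensity I hr hD]
          · intro i _
            have (j : ℕ) := measurable_logDensity (r j) D (a i j)
            fun_prop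
  have hexpi : Integrable (fun u => Real.exp (f u)) whiteNoise := by
    refine ⟨Real.continuous_exp.comp_aestronglyMeasurable hfi.aestronglyMeasurable, ?_⟩
    rw [hasFiniteIntegral_iff_ofReal (ae_of_all _ fun u => (Real.exp_pos _).le)]
    exact hexp.trans_lt (ENNReal.natCast_lt_top N)
  have hexp' : ∫ u, Real.exp (f u) ∂whiteNoise ≤ N := by
    rw [integral_eq_lintegral_of_nonneg_ae (ae_of_all _ fun u => (Real.exp_pos _).le)
      hexpi.aestronglyMeasurable]
    exact ENNReal.toReal_le_of_le_ofReal hN'.le (by simpa using hexp)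
  -- Jensen's inequality for `exp`, through the tangent line `x + 1 ≤ exp x` at `x = f u - log N`.
  have hfle : ∫ u, f u ∂whiteNoise ≤ Real.log N := by
    have : ∫ u, f u ∂whiteNoise ≤ ∫ u, (Real.log N - 1 + Real.exp (f u) / N) ∂whiteNoise := by
      refine integral_mono hfi ((integrable_const _).add (hexpi.div_const _)) fun u => ?_
      have := Real.add_one_le_exp (f u - Real.log N)
      rw [Real.exp_sub, Real.exp_log hN'] at this
      show f u ≤ _
      linarith
    rw [integral_add (integrable_const _) (hexpi.div_const _), integral_div] at this
    have h1 : (∫ u, Real.exp (f u) ∂whiteNoise) / N ≤ 1 := (div_le_one hN').2 hexp'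
    simp at this
    linarith
  have hfeq : ∫ u, f u ∂whiteNoise = 1 / 2 * ∑ j ∈ I, Real.log (r j ^ 2)
      - I.card * Real.log D / 2 + I.card / 2
      - (∫ u, ∑ j ∈ I, (r j * u j - a (k u) j) ^ 2 ∂whiteNoise) / (2 * D) := by
    rw [integral_finsetSum _ fun j _ => hint j, integral_finsetSum _ fun j _ => hld j,
      Finset.sum_div, Finset.mul_sum]
    have (j : ℕ) (hj : j ∈ I) : ∫ u, logDensity (r j) D (a (k u) j) (u j) ∂whiteNoise =
        1 / 2 * Real.log (r j ^ 2) - Real.log D / 2 + 1 / 2 -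
          (∫ u, (r j * u j - a (k u) j) ^ 2 ∂whiteNoise) / (2 * D) := by
      unfold logDensity
      have hadd : Integrable (fun u : ℕ → ℝ => 1 / 2 * Real.log (r j ^ 2 / D) + u j ^ 2 / 2)
        whiteNoise := (integrable_const _).add ((hsq j).div_const 2)
      rw [integral_sub hadd ((hint j).div_const (2 * D)), integral_add (integrable_const _) ((hsq j).div_const 2),
        integral_div, integral_div, integral_sq_eval_whiteNoise, Real.log_div
        (pow_ne_zero _ (hr j hj).ne') hD.ne']
      simp
      ring
    rw [Finset.sum_congr rfl this]
    simp only [Finset.sum_sub_distrib, Finset.sum_add_distrib, Finset.sum_const, nsmul_eq_mul]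
    ring
  rw [hfeq] at hfle
  set E := ∫ u, ∑ j ∈ I, (r j * u j - a (k u) j) ^ 2 ∂whiteNoise
  have : E / (2 * D) * (2 * D) = E := by field_simp
  nlinarith

/-- The Shannon lower bound for the quantization of a Gaussian vector. -/
theorem gaussian_quantization_bound {I : Finset ℕ} (hI : I.Nonempty) {r : ℕ → ℝ}
    (hr : ∀ j ∈ I, 0 < r j) {N : ℕ} {k : (ℕ → ℝ) → Fin N} (hk : Measurable k)
    (a : Fin N → ℕ → ℝ) :
    I.card * Real.exp ((∑ j ∈ I, Real.log (r j ^ 2) - 2 * Real.log N) / I.card) ≤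
      ∫ u, ∑ j ∈ I, (r j * u j - a (k u) j) ^ 2 ∂whiteNoise := by
  -- This `D` maximizes the trial bound; the bracket there then collapses to `I.card`.
  refine le_trans (le_of_eq ?_) (gaussian_quantization_bound_trial I hr (Real.exp_pos
    ((∑ j ∈ I, Real.log (r j ^ 2) - 2 * Real.log N) / I.card)) hk a)
  rw [Real.log_exp]
  have : (I.card : ℝ) ≠ 0 := by exact_mod_cast hI.card_pos.ne'
  field_simp
  ring

/-! ### Bayes risk of a quantized estimator -/

/-- Supplies the angle of the rotation that sends prior and noise variables to the normalized
observation and a variable independent of it. -/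
theorem exists_polar {a b : ℝ} (ha : 0 ≤ a) (hb : 0 < b) :
    ∃ t : ℝ, Real.cos t = a / √(a ^ 2 + b ^ 2) ∧ Real.sin t = b / √(a ^ 2 + b ^ 2) := by
  have hpos : 0 < a ^ 2 + b ^ 2 := by positivity
  have hsq : √(a ^ 2 + b ^ 2) ^ 2 = a ^ 2 + b ^ 2 := Real.sq_sqrt hpos.le
  have hs : 0 < √(a ^ 2 + b ^ 2) := Real.sqrt_pos.2 hpos
  have hle : a / √(a ^ 2 + b ^ 2) ≤ 1 := by
    rw [div_le_one hs]; exact Real.le_sqrt_of_sq_le (by nlinarith)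
  refine ⟨Real.arccos (a / √(a ^ 2 + b ^ 2)),
    Real.cos_arccos (by linarith [div_nonneg ha hs.le]) hle, ?_⟩
  rw [Real.sin_arccos, ← Real.sqrt_sq (div_pos hb hs).le]
  congr 1
  rw [div_pow, div_pow, hsq]
  field_simp
  ring

/-- The expected loss for a signal `r u - b w` whose second component is independent of the
codeword splits into the loss for the first component and the variance of the second. -/
theorem integral_loss_add_noise (I : Finset ℕ) (r b : ℕ → ℝ) {N : ℕ} {k : (ℕ → ℝ) → Fin N}
    (hk : Measurable k) (a : Fin N → ℕ → ℝ) :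
    ∫ p, ∑ j ∈ I, (r j * p.1 j - b j * p.2 j - a (k p.1) j) ^ 2 ∂(whiteNoise.prod whiteNoise) =
      ∑ j ∈ I, b j ^ 2 + ∫ u, ∑ j ∈ I, (r j * u j - a (k u) j) ^ 2 ∂whiteNoise := by
  have hA (j : ℕ) : MemLp (fun u : ℕ → ℝ => r j * u j - a (k u) j) 2 whiteNoise :=
    ((memLp_eval_whiteNoise j 2).const_mul (r j)).sub (memLp_codeword hk (fun i => a i j) 2)
  have hW (j : ℕ) : MemLp (fun u : ℕ → ℝ => u j) 2 whiteNoise := memLp_eval_whiteNoise j 2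
  have h1 (j : ℕ) : Integrable (fun p : (ℕ → ℝ) × (ℕ → ℝ) => (r j * p.1 j - a (k p.1) j) ^ 2)
      (whiteNoise.prod whiteNoise) := (hA j).integrable_sq.comp_fst whiteNoise
  have h2 (j : ℕ) : Integrable (fun p : (ℕ → ℝ) × (ℕ → ℝ) =>
      (r j * p.1 j - a (k p.1) j) * p.2 j) (whiteNoise.prod whiteNoise) :=
    ((hA j).integrable (by norm_num)).mul_prod ((hW j).integrable (by norm_num))
  have h3 (j : ℕ) : Integrable (fun p : (ℕ → ℝ) × (ℕ → ℝ) => p.2 j ^ 2)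
      (whiteNoise.prod whiteNoise) := (hW j).integrable_sq.comp_snd whiteNoise
  have hexp (j : ℕ) : (fun p : (ℕ → ℝ) × (ℕ → ℝ) =>
      (r j * p.1 j - b j * p.2 j - a (k p.1) j) ^ 2) = fun p => (r j * p.1 j - a (k p.1) j) ^ 2 +
        (-2 * b j) * ((r j * p.1 j - a (k p.1) j) * p.2 j) + b j ^ 2 * p.2 j ^ 2 := by
    funext p; ring
  have h12 (j : ℕ) : Integrable (fun p : (ℕ → ℝ) × (ℕ → ℝ) => (r j * p.1 j - a (k p.1) j) ^ 2 +
      (-2 * b j) * ((r j * p.1 j - a (k p.1) j) * p.2 j)) (whiteNoise.prod whiteNoise) :=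
    (h1 j).add ((h2 j).const_mul _)
  have hint (j : ℕ) : Integrable (fun p : (ℕ → ℝ) × (ℕ → ℝ) =>
      (r j * p.1 j - b j * p.2 j - a (k p.1) j) ^ 2) (whiteNoise.prod whiteNoise) := by
    rw [hexp]
    exact (h12 j).add ((h3 j).const_mul _)
  rw [integral_finsetSum _ fun j _ => hint j,
    integral_finsetSum _ fun j _ => (hA j).integrable_sq, ← Finset.sum_add_distrib]
  refine Finset.sum_congr rfl fun j _ => ?_
  rw [hexp, integral_add (h12 j) ((h3 j).const_mul _), integral_add (h1 j) ((h2 j).const_mul _),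
    integral_const_mul, integral_const_mul,
    integral_prod_mul (μ := whiteNoise) (ν := whiteNoise)
      (fun u : ℕ → ℝ => r j * u j - a (k u) j) (fun w : ℕ → ℝ => w j),
    integral_eval_whiteNoise]
  have e1 := integral_prod_mul (μ := whiteNoise) (ν := whiteNoise)
    (fun u : ℕ → ℝ => (r j * u j - a (k u) j) ^ 2) (fun _ => (1 : ℝ))
  have e2 := integral_prod_mul (μ := whiteNoise) (ν := whiteNoise)
    (fun _ => (1 : ℝ)) (fun w : ℕ → ℝ => w j ^ 2)
  simp only [mul_one, one_mul, integral_const, probReal_univ, smul_eq_mul,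
    integral_sq_eval_whiteNoise] at e1 e2
  rw [e1, e2]
  ring

/-- Lower bound for the Bayes risk of a quantized estimator under a Gaussian prior with independent
coordinates of standard deviation `sd j`. -/
theorem bayes_risk_bound {I : Finset ℕ} (hI : I.Nonempty) {sd : ℕ → ℝ} (hsd : ∀ j, 0 ≤ sd j)
    (hsdI : ∀ j ∈ I, 0 < sd j) {ε : ℝ} (hε : 0 < ε) {N : ℕ} {k : (ℕ → ℝ) → Fin N}
    (hk : Measurable k) (a : Fin N → ℕ → ℝ) :
    ∑ j ∈ I, sd j ^ 2 * ε ^ 2 / (sd j ^ 2 + ε ^ 2) + I.card *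
        Real.exp ((∑ j ∈ I, Real.log ((sd j ^ 2) ^ 2 / (sd j ^ 2 + ε ^ 2)) - 2 * Real.log N) /
          I.card) ≤
      ∫ p, ∑ j ∈ I, (sd j * p.1 j - a (k fun i => sd i * p.1 i + ε * p.2 i) j) ^ 2
        ∂(whiteNoise.prod whiteNoise) := by
  -- After rotation `p.1 j` is `Y_j / ρ j` and `p.2` is independent of the data. The signal becomes
  -- `sd ^ 2 / ρ * p.1 - sd * ε / ρ * p.2`: posterior mean plus an error whose variance is the
  -- posterior variance.
  choose t hcos hsin using fun j => exists_polar (hsd j) hε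
  set ρ : ℕ → ℝ := fun j => √(sd j ^ 2 + ε ^ 2) with hρ
  have hρpos (j : ℕ) : 0 < ρ j := Real.sqrt_pos.2 (by positivity)
  have hρsq (j : ℕ) : ρ j ^ 2 = sd j ^ 2 + ε ^ 2 := Real.sq_sqrt (by positivity)
  have hk' : Measurable fun u : ℕ → ℝ => k fun i => ρ i * u i := hk.comp (by fun_prop)
  have hmain := gaussian_quantization_bound hI (r := fun j => sd j ^ 2 / ρ j)
    (fun j hj => div_pos (pow_pos (hsdI j hj) 2) (hρpos j)) hk' a
  have hloss := integral_loss_add_noise I (fun j => sd j ^ 2 / ρ j) (fun j => sd j * ε / ρ j) hk' a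
  have hrot : ∫ p, ∑ j ∈ I, (sd j * p.1 j - a (k fun i => sd i * p.1 i + ε * p.2 i) j) ^ 2
        ∂(whiteNoise.prod whiteNoise) =
      ∫ p, ∑ j ∈ I, (sd j ^ 2 / ρ j * p.1 j - sd j * ε / ρ j * p.2 j
        - a (k fun i => ρ i * p.1 i) j) ^ 2 ∂(whiteNoise.prod whiteNoise) := by
    conv_rhs => rw [← map_rotation_whiteNoise t]
    rw [integral_map (by fun_prop)]
    · refine integral_congr_ae (ae_of_all _ fun p => ?_)
      have e1 : (fun i => ρ i * (Real.cos (t i) * p.1 i + Real.sin (t i) * p.2 i)) =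
          fun i => sd i * p.1 i + ε * p.2 i := by
        funext i
        have := (hρpos i).ne'
        rw [hcos, hsin]
        change ρ i * (sd i / ρ i * p.1 i + ε / ρ i * p.2 i) = _
        field_simp
      simp only [e1]
      refine Finset.sum_congr rfl fun j _ => ?_
      congr 2
      have := (hρpos j).ne'
      rw [hcos, hsin]
      change sd j * p.1 j = sd j ^ 2 / ρ j * (sd j / ρ j * p.1 j + ε / ρ j * p.2 j) -
        sd j * ε / ρ j * (-(ε / ρ j) * p.1 j + sd j / ρ j * p.2 j)
      field_simp
      rw [hρsq]
      ring
    · have (j : ℕ) : Measurable fun p : (ℕ → ℝ) × (ℕ → ℝ) => a (k fun i => ρ i * p.1 i) j :=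
        (measurable_of_finite fun i => a i j).comp (hk'.comp measurable_fst)
      exact Measurable.aestronglyMeasurable (by fun_prop)
  rw [hrot, hloss]
  refine add_le_add (le_of_eq ?_) (le_trans (le_of_eq ?_) hmain)
  · refine Finset.sum_congr rfl fun j _ => ?_
    rw [div_pow, hρsq, mul_pow]
  · congr 4
    refine Finset.sum_congr rfl fun j _ => ?_
    rw [div_pow, hρsq]

/-! ### From the Bayes risk to the minimax risk over the ellipsoid -/

/-- The variance of the square of a standard Gaussian variable. -/
def sqVariance : ℝ := Var[fun x : ℝ => x ^ 2; gaussianReal 0 1]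

theorem sqVariance_nonneg : 0 ≤ sqVariance := variance_nonneg _ _

theorem memLp_sq_gaussianReal : MemLp (fun x : ℝ => x ^ 2) 2 (gaussianReal 0 1) := by
  rw [memLp_two_iff_integrable_sq (by fun_prop)]
  have h := (memLp_id_gaussianReal (μ := 0) (v := 1) 4).integrable_norm_pow (by norm_num)
  refine h.congr (ae_of_all _ fun x => ?_)
  simp only [id, Real.norm_eq_abs]
  rw [← pow_mul]
  exact Even.pow_abs (by decide) x

theorem memLp_sq_eval_whiteNoise (j : ℕ) : MemLp (fun u : ℕ → ℝ => u j ^ 2) 2 whiteNoise :=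
  memLp_sq_gaussianReal.comp_measurePreserving (measurePreserving_eval_whiteNoise j)

theorem integrable_sq_sub_whiteNoise (I : Finset ℕ) (w : ℕ → ℝ) :
    Integrable (fun u : ℕ → ℝ => (∑ j ∈ I, w j * u j ^ 2 - ∑ j ∈ I, w j) ^ 2) whiteNoise := by
  have h : MemLp (fun u : ℕ → ℝ => ∑ j ∈ I, w j * u j ^ 2) 2 whiteNoise :=
    memLp_finsetSum _ fun j _ => (memLp_sq_eval_whiteNoise j).const_mul (w j)
  exact (h.sub (memLp_const _)).integrable_sq

theorem integral_sq_sub_whiteNoise (I : Finset ℕ) (w : ℕ → ℝ) :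
    ∫ u, (∑ j ∈ I, w j * u j ^ 2 - ∑ j ∈ I, w j) ^ 2 ∂whiteNoise =
      sqVariance * ∑ j ∈ I, w j ^ 2 := by
  have hX (j : ℕ) : MemLp (fun u : ℕ → ℝ => w j * u j ^ 2) 2 whiteNoise :=
    (memLp_sq_eval_whiteNoise j).const_mul (w j)
  have hmean : ∫ u, ∑ j ∈ I, w j * u j ^ 2 ∂whiteNoise = ∑ j ∈ I, w j := by
    rw [integral_finsetSum _ fun j _ => (hX j).integrable (by norm_num)]
    simp [integral_const_mul, integral_sq_eval_whiteNoise]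
  have hind : iIndepFun (fun (j : ℕ) (u : ℕ → ℝ) => w j * u j ^ 2) whiteNoise :=
    iIndepFun_infinitePi (P := fun _ => gaussianReal 0 1) (X := fun j x => w j * x ^ 2)
      (by fun_prop)
  have hvar := IndepFun.variance_sum (s := I) (fun j _ => hX j)
    fun i _ j _ hij => hind.indepFun hij
  have hone (j : ℕ) : Var[fun u : ℕ → ℝ => w j * u j ^ 2; whiteNoise] = w j ^ 2 * sqVariance := by
    rw [variance_const_mul, sqVariance, ← (measurePreserving_eval_whiteNoise j).map_eq,
      variance_map (Y := fun u : ℕ → ℝ => u j) (by fun_prop)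
        (measurable_pi_apply j).aemeasurable]
    rfl
  rw [variance_eq_integral (Finset.aemeasurable_sum _ fun j _ =>
    (hX j).aestronglyMeasurable.aemeasurable)] at hvar
  simp only [Finset.sum_apply, hmean, hone] at hvar
  rw [hvar, ← Finset.sum_mul, mul_comm]

/-- The constant in the bound for the loss of a bounded decoder outside of the ellipsoid. -/
def excessConst (C δ : ℝ) : ℝ := 2 / (δ * C) + 10 * C / (δ * C) ^ 2

theorem excessConst_nonneg {C δ : ℝ} (hC : 0 < C) (hδ : 0 < δ) : 0 ≤ excessConst C δ := by
  unfold excessConst; positivity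

/-- Once `S` exceeds `C` it exceeds `μ` by at least `δ * C`, so both constants and multiples of `S -
μ` are dominated by `(S - μ) ^ 2`, as in Chebyshev's inequality. The `10` in `excessConst` comes
from `2 * μ + 8 * C ≤ 10 * C`. -/
theorem excess_le {C δ S μ : ℝ} (hC : 0 < C) (hδ : 0 < δ) (hμ : μ ≤ (1 - δ) * C)
    (hS : C < S) : 2 * S + 8 * C ≤ excessConst C δ * (S - μ) ^ 2 := by
  have hgap : δ * C ≤ S - μ := by linarith
  have hδC : 0 < δ * C := by positivity
  have h1 : S - μ ≤ (S - μ) ^ 2 / (δ * C) := by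
    rw [le_div_iff₀ hδC]; nlinarith
  have h2 : 1 ≤ (S - μ) ^ 2 / (δ * C) ^ 2 := by
    rw [one_le_div (by positivity)]; nlinarith
  have h3 : excessConst C δ * (S - μ) ^ 2 =
      2 * ((S - μ) ^ 2 / (δ * C)) + 10 * C * ((S - μ) ^ 2 / (δ * C) ^ 2) := by
    unfold excessConst; ring
  rw [h3]
  nlinarith

/-- The decoder that answers `0` whenever the codeword has squared norm larger than `4 * R`. -/
def truncateCodeword (I : Finset ℕ) (R : ℝ) (a : ℕ → ℝ) : ℕ → ℝ :=
  if ∑ j ∈ I, a j ^ 2 ≤ 4 * R then a else 0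

/-- A codeword of norm above `2 √R` is farther from `θ` than `√R`, whereas `0` is within `√R`.
Truncation therefore never hurts for signals in the ball. -/
theorem sum_sub_truncateCodeword_le {I : Finset ℕ} {R : ℝ} {θ : ℕ → ℝ} (a : ℕ → ℝ)
    (hθ : ∑ j ∈ I, θ j ^ 2 ≤ R) :
    ∑ j ∈ I, (θ j - truncateCodeword I R a j) ^ 2 ≤ ∑ j ∈ I, (θ j - a j) ^ 2 := by
  unfold truncateCodeword
  split_ifs with h
  · exact le_rfl
  · have h1 : ∑ j ∈ I, a j ^ 2 ≤ ∑ j ∈ I, (2 * θ j ^ 2 + 2 * (θ j - a j) ^ 2) :=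
      Finset.sum_le_sum fun j _ => by nlinarith [sq_nonneg (θ j + (θ j - a j))]
    rw [Finset.sum_add_distrib, ← Finset.mul_sum, ← Finset.mul_sum] at h1
    simp only [Pi.zero_apply, sub_zero]
    linarith

theorem sum_sub_truncateCodeword_le' {I : Finset ℕ} {R : ℝ} (hR : 0 ≤ R) (θ a : ℕ → ℝ) :
    ∑ j ∈ I, (θ j - truncateCodeword I R a j) ^ 2 ≤ 2 * ∑ j ∈ I, θ j ^ 2 + 8 * R := by
  have h1 : ∑ j ∈ I, (θ j - truncateCodeword I R a j) ^ 2 ≤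
      ∑ j ∈ I, (2 * θ j ^ 2 + 2 * truncateCodeword I R a j ^ 2) :=
    Finset.sum_le_sum fun j _ => by nlinarith [sq_nonneg (θ j + truncateCodeword I R a j)]
  rw [Finset.sum_add_distrib, ← Finset.mul_sum, ← Finset.mul_sum] at h1
  have h2 : ∑ j ∈ I, truncateCodeword I R a j ^ 2 ≤ 4 * R := by
    unfold truncateCodeword
    split_ifs with h
    · exact h
    · simpa using hR
  linarith

theorem lintegral_dataLaw_eq (θ : ℕ → ℝ) (ε : ℝ) {f : (ℕ → ℝ) → ℝ≥0∞} (hf : Measurable f) :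
    ∫⁻ y, f y ∂dataLaw θ ε = ∫⁻ z, f (fun j => θ j + ε * z j) ∂whiteNoise := by
  rw [dataLaw_eq_map, lintegral_map hf (by fun_prop)]

theorem mem_sobolevEllipsoid_of_support {m c : ℝ} {I : Finset ℕ} {θ : ℕ → ℝ}
    (hθ : ∀ j ∉ I, θ j = 0)
    (h : ∑ j ∈ I, weight m j ^ 2 * θ j ^ 2 ≤ c ^ 2 / Real.pi ^ (2 * m)) :
    θ ∈ sobolevEllipsoid m c := by
  have hz (j : ℕ) (hj : j ∉ I) : weight m j ^ 2 * θ j ^ 2 = 0 := by simp [hθ j hj]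
  refine ⟨?_, summable_of_ne_finset_zero hz, by rwa [tsum_eq_sum hz]⟩
  refine memℓp_gen (summable_of_ne_finset_zero (s := I) fun j hj => ?_)
  simp [hθ j hj]

/-- A nonasymptotic lower bound for the quantized minimax risk: the Bayes risk for a Gaussian prior
on finitely many coordinates, corrected for the mass that the prior puts outside of the
ellipsoid. -/
theorem minimaxRisk_ge {m c : ℝ} (hc : 0 < c) {I : Finset ℕ} (hI : I.Nonempty)
    {sd : ℕ → ℝ} (hsdI : ∀ j ∈ I, 0 < sd j) (hsd0 : ∀ j ∉ I, sd j = 0)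
    {ε δ P b : ℝ} (hε : 0 < ε) (hδ : 0 < δ) (hP : 0 < P) (hPw : ∀ j ∈ I, P ≤ weight m j ^ 2)
    (henergy : ∑ j ∈ I, weight m j ^ 2 * sd j ^ 2 ≤ (1 - δ) * (c ^ 2 / Real.pi ^ (2 * m))) :
    ENNReal.ofReal (∑ j ∈ I, sd j ^ 2 * ε ^ 2 / (sd j ^ 2 + ε ^ 2) + I.card *
        Real.exp ((∑ j ∈ I, Real.log ((sd j ^ 2) ^ 2 / (sd j ^ 2 + ε ^ 2)) -
          2 * (b * Real.log 2)) / I.card) -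
        excessConst (c ^ 2 / Real.pi ^ (2 * m)) δ * sqVariance / P *
          ∑ j ∈ I, (weight m j ^ 2 * sd j ^ 2) ^ 2) ≤ minimaxRisk m c ε b := by
  set C : ℝ := c ^ 2 / Real.pi ^ (2 * m) with hCdef
  have hC : 0 < C := by have := Real.pi_pos; positivity
  have hsd (j : ℕ) : 0 ≤ sd j := by
    by_cases hj : j ∈ I
    · exact (hsdI j hj).le
    · exact (hsd0 j hj).ge
  refine le_iInf₂ fun T hT => ?_
  obtain ⟨N, hN, φ, ψ, hφ, rfl⟩ := hT
  set a : Fin N → ℕ → ℝ := fun k => truncateCodeword I (C / P) (ψ k) with ha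
  set Y : (ℕ → ℝ) × (ℕ → ℝ) → ℕ → ℝ := fun p i => sd i * p.1 i + ε * p.2 i with hY
  set F : (ℕ → ℝ) × (ℕ → ℝ) → ℝ := fun p => ∑ j ∈ I, (sd j * p.1 j - a (φ (Y p)) j) ^ 2 with hF
  set S : (ℕ → ℝ) → ℝ := fun ξ => ∑ j ∈ I, weight m j ^ 2 * sd j ^ 2 * ξ j ^ 2 with hS
  set μ : ℝ := ∑ j ∈ I, weight m j ^ 2 * sd j ^ 2 with hμ
  set Rsup : ℝ≥0∞ := ⨆ θ ∈ sobolevEllipsoid m c, risk ε (ψ ∘ φ) θ with hRsup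
  have hYm : Measurable Y := by fun_prop
  have ham (j : ℕ) : MemLp (fun p => a (φ (Y p)) j) 2 (whiteNoise.prod whiteNoise) :=
    memLp_codeword (hφ.comp hYm) (fun k => a k j) 2
  have hFint : Integrable F (whiteNoise.prod whiteNoise) :=
    integrable_finsetSum _ fun j _ =>
      ((((memLp_eval_whiteNoise j 2).comp_fst whiteNoise).const_mul (sd j)).sub
        (ham j)).integrable_sq
  have hF0 (p) : 0 ≤ F p := Finset.sum_nonneg fun _ _ => sq_nonneg _
  have hFm : Measurable F := by
    have (j : ℕ) : Measurable fun p => a (φ (Y p)) j :=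
      (measurable_of_finite fun k => a k j).comp (hφ.comp hYm)
    fun_prop
  -- All weights on `I` are at least `P`, so energy controls the norm; this is why the truncation
  -- radius is `C / P`.
  have hθS (ξ : ℕ → ℝ) : ∑ j ∈ I, (sd j * ξ j) ^ 2 ≤ S ξ / P := by
    rw [le_div_iff₀ hP, Finset.sum_mul]
    refine Finset.sum_le_sum fun j hj => ?_
    nlinarith [mul_le_mul_of_nonneg_left (hPw j hj) (sq_nonneg (sd j * ξ j))]
  -- Inside the ellipsoid truncation only lowers the loss, so the risk is at most the supremum.
  -- Outside, the truncated loss is at most `(2 * S ξ + 8 * C) / P`, which `excess_le` charges to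
  -- the squared deviation of the energy.
  have hpt (ξ : ℕ → ℝ) : ∫⁻ z, ENNReal.ofReal (F (ξ, z)) ∂whiteNoise ≤
      Rsup + ENNReal.ofReal (excessConst C δ / P * (S ξ - μ) ^ 2) := by
    by_cases hξ : S ξ ≤ C
    · refine le_trans ?_ le_self_add
      have hmem : (fun j => sd j * ξ j) ∈ sobolevEllipsoid m c := by
        refine mem_sobolevEllipsoid_of_support (I := I) (fun j hj => by simp [hsd0 j hj]) ?_
        refine le_trans (le_of_eq ?_) hξ
        exact Finset.sum_congr rfl fun j _ => by ring
      refine le_trans ?_ (le_iSup₂ (f := fun θ (_ : θ ∈ sobolevEllipsoid m c) =>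
        risk ε (ψ ∘ φ) θ) _ hmem)
      refine le_trans (lintegral_mono fun z => ?_) (lintegral_dataLaw_eq _ ε
        ((measurable_of_finite fun k => sqDist (fun j => sd j * ξ j) (ψ k)).comp hφ)).ge
      calc ENNReal.ofReal (F (ξ, z))
          ≤ ENNReal.ofReal (∑ j ∈ I, (sd j * ξ j - ψ (φ (Y (ξ, z))) j) ^ 2) :=
            ENNReal.ofReal_le_ofReal (sum_sub_truncateCodeword_le _
              ((hθS ξ).trans (by gcongr)))
        _ = ∑ j ∈ I, ENNReal.ofReal ((sd j * ξ j - ψ (φ (Y (ξ, z))) j) ^ 2) :=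
            ENNReal.ofReal_sum_of_nonneg fun _ _ => sq_nonneg _
        _ ≤ _ := ENNReal.sum_le_tsum I
    · refine le_trans ?_ le_add_self
      push Not at hξ
      calc ∫⁻ z, ENNReal.ofReal (F (ξ, z)) ∂whiteNoise
          ≤ ∫⁻ _, ENNReal.ofReal (excessConst C δ / P * (S ξ - μ) ^ 2) ∂whiteNoise := by
            refine lintegral_mono fun z => ENNReal.ofReal_le_ofReal ?_
            have h1 := sum_sub_truncateCodeword_le' (I := I) (R := C / P) (by positivity)
              (fun j => sd j * ξ j) (ψ (φ (Y (ξ, z))))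
            have h2 := excess_le hC hδ henergy hξ
            have h3 := hθS ξ
            calc F (ξ, z) ≤ 2 * (S ξ / P) + 8 * (C / P) := h1.trans (by linarith)
              _ = (2 * S ξ + 8 * C) / P := by ring
              _ ≤ (excessConst C δ * (S ξ - μ) ^ 2) / P := by gcongr
              _ = _ := by ring
        _ = _ := by simp
  have hvar := integral_sq_sub_whiteNoise I fun j => weight m j ^ 2 * sd j ^ 2
  have hvari := integrable_sq_sub_whiteNoise I fun j => weight m j ^ 2 * sd j ^ 2
  have hKP : 0 ≤ excessConst C δ / P := div_nonneg (excessConst_nonneg hC hδ) hP.le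
  have htotal : ENNReal.ofReal (∫ p, F p ∂(whiteNoise.prod whiteNoise)) ≤ Rsup +
      ENNReal.ofReal (excessConst C δ / P * (sqVariance *
        ∑ j ∈ I, (weight m j ^ 2 * sd j ^ 2) ^ 2)) := by
    rw [ofReal_integral_eq_lintegral_ofReal hFint (ae_of_all _ hF0),
      lintegral_prod _ (by fun_prop), ← hvar, ← integral_const_mul,
      ofReal_integral_eq_lintegral_ofReal (hvari.const_mul _)
        (ae_of_all _ fun ξ => mul_nonneg hKP (sq_nonneg _))]
    calc _ ≤ ∫⁻ ξ, (Rsup + ENNReal.ofReal (excessConst C δ / P * (S ξ - μ) ^ 2)) ∂whiteNoise :=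
          lintegral_mono hpt
      _ = _ := by
          rw [lintegral_add_left measurable_const]
          simp [S, μ]
  have hbayes := bayes_risk_bound hI hsd hsdI hε hφ a
  -- A value of the encoder witnesses `N ≠ 0`, so that `log N` can be compared with `b * log 2`.
  have hN0 : 0 < N := (φ 0).pos
  have hlogN : Real.log N ≤ b * Real.log 2 := by
    rw [← Real.log_rpow two_pos]
    exact Real.log_le_log (by exact_mod_cast hN0) hN
  rw [ENNReal.ofReal_sub _ (mul_nonneg (div_nonneg (mul_nonneg (excessConst_nonneg hC hδ)
    sqVariance_nonneg) hP.le) (Finset.sum_nonneg fun _ _ => sq_nonneg _)), tsub_le_iff_right]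
  refine le_trans (ENNReal.ofReal_le_ofReal (le_trans ?_ hbayes)) (htotal.trans (le_of_eq ?_))
  · gcongr
  · congr 2
    ring

/-! ### Riemann sums on a grid of mesh `h` -/

/-- The `j` for which the cell `[j h, (j + 1) h]` lies in `[κ, X]`. -/
def gridIndices (κ X h : ℝ) : Finset ℕ := Finset.Ico ⌈κ / h⌉₊ ⌊X / h⌋₊

section Grid

variable {κ X h : ℝ}

theorem bounds_of_mem_gridIndices (hκ : 0 < κ) (hκX : κ < X) (hh : 0 < h) {j : ℕ}
    (hj : j ∈ gridIndices κ X h) : κ ≤ j * h ∧ ((j : ℝ) + 1) * h ≤ X := by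
  rw [gridIndices, Finset.mem_Ico] at hj
  refine ⟨(div_le_iff₀ hh).1 (Nat.ceil_le.1 hj.1), ?_⟩
  have h2 := (Nat.le_floor_iff (div_nonneg (hκ.trans hκX).le hh.le)).1 (Nat.succ_le_of_lt hj.2)
  push_cast at h2
  exact (le_div_iff₀ hh).1 h2

theorem grid_endpoints (hκ : 0 < κ) (hh : 0 < h) (h2 : 2 * h ≤ X - κ) :
    κ ≤ ⌈κ / h⌉₊ * h ∧ ⌈κ / h⌉₊ * h < κ + h ∧ X - h < ⌊X / h⌋₊ * h ∧ ⌊X / h⌋₊ * h ≤ X ∧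
      ⌈κ / h⌉₊ < ⌊X / h⌋₊ := by
  have hX : 0 < X := by linarith
  have h1 : κ ≤ ⌈κ / h⌉₊ * h := (div_le_iff₀ hh).1 (Nat.le_ceil _)
  have h3 : ⌈κ / h⌉₊ * h < κ + h := by
    have := Nat.ceil_lt_add_one (div_nonneg hκ.le hh.le)
    calc ⌈κ / h⌉₊ * h < (κ / h + 1) * h := by gcongr
      _ = κ + h := by field_simp
  have h4 : X - h < ⌊X / h⌋₊ * h := by
    have := Nat.sub_one_lt_floor (X / h)
    calc X - h = (X / h - 1) * h := by field_simp
      _ < _ := by gcongr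
  have h5 : ⌊X / h⌋₊ * h ≤ X := (le_div_iff₀ hh).1 (Nat.floor_le (div_nonneg hX.le hh.le))
  refine ⟨h1, h3, h4, h5, ?_⟩
  have : (⌈κ / h⌉₊ : ℝ) * h < ⌊X / h⌋₊ * h := by linarith
  exact_mod_cast lt_of_mul_lt_mul_right this hh.le

theorem card_gridIndices (hκ : 0 < κ) (hh : 0 < h) (h2 : 2 * h ≤ X - κ) :
    X - κ - 2 * h ≤ (gridIndices κ X h).card * h ∧ (gridIndices κ X h).card * h ≤ X - κ := by
  obtain ⟨h1, h3, h4, h5, h6⟩ := grid_endpoints hκ hh h2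
  rw [gridIndices, Nat.card_Ico, Nat.cast_sub h6.le, sub_mul]
  constructor <;> linarith

theorem gridIndices_nonempty (hκ : 0 < κ) (hh : 0 < h) (h2 : 2 * h ≤ X - κ) :
    (gridIndices κ X h).Nonempty :=
  Finset.nonempty_Ico.2 (grid_endpoints hκ hh h2).2.2.2.2

/-- The right Riemann sum of an antitone function bounds its integral up to `O(h)`. -/
theorem integral_le_grid_sum {f : ℝ → ℝ} (hκ : 0 < κ) (hh : 0 < h) (h2 : 2 * h ≤ X - κ)
    (hf : AntitoneOn f (Set.Icc κ X)) :
    ∫ x in κ..X, f x ≤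
      h * ∑ j ∈ gridIndices κ X h, f (((j : ℝ) + 1) * h) + h * (4 * (|f κ| + |f X|)) := by
  obtain ⟨h1, h3, h4, h5, h6⟩ := grid_endpoints hκ hh h2
  rw [gridIndices]
  set p := ⌈κ / h⌉₊
  set q := ⌊X / h⌋₊
  set M := |f κ| + |f X|
  have hκX : κ < X := by linarith
  have hpq : (p : ℝ) * h < q * h := by gcongr
  have hbd (x : ℝ) (hx : x ∈ Set.Icc κ X) : |f x| ≤ M := by
    have ha := hf ⟨le_rfl, hκX.le⟩ hx hx.1
    have hb := hf hx ⟨hκX.le, le_rfl⟩ hx.2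
    rw [abs_le]
    constructor
    · linarith [neg_abs_le (f X), abs_nonneg (f κ)]
    · linarith [le_abs_self (f κ), abs_nonneg (f X)]
  have hint (a b : ℝ) (ha : κ ≤ a) (hab : a ≤ b) (hb : b ≤ X) : IntervalIntegrable f volume a b := by
    refine AntitoneOn.intervalIntegrable (hf.mono ?_)
    rw [Set.uIcc_of_le hab]
    exact Set.Icc_subset_Icc ha hb
  have hi1 := hint κ (p * h) le_rfl h1 (by linarith)
  have hi2 := hint (p * h) (q * h) h1 hpq.le h5
  have hi3 := hint (q * h) X (by linarith) h5 le_rfl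
  have hedge (a b : ℝ) (ha : κ ≤ a) (hab : a ≤ b) (hb : b ≤ X) (hlen : b - a ≤ h) :
      ∫ x in a..b, f x ≤ M * h := by
    have := intervalIntegral.norm_integral_le_of_norm_le_const (C := M) (f := f) (a := a) (b := b)
      fun x hx => by
        rw [Set.uIoc_of_le hab] at hx
        exact hbd x ⟨ha.trans hx.1.le, hx.2.trans hb⟩
    rw [Real.norm_eq_abs, abs_of_nonneg (sub_nonneg.2 hab)] at this
    have hM : 0 ≤ M := by positivity
    nlinarith [le_abs_self (∫ x in a..b, f x)]
  have e1 := hedge κ (p * h) le_rfl h1 (by linarith) (by linarith)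
  have e3 := hedge (q * h) X (by linarith) h5 le_rfl (by linarith)
  have hg : AntitoneOn (fun t : ℝ => f (t * h)) (Set.Icc (p : ℝ) q) := fun x hx y hy hxy =>
    hf ⟨h1.trans (by gcongr; exact hx.1), le_trans (by gcongr; exact hx.2) h5⟩
      ⟨h1.trans (by gcongr; exact hy.1), le_trans (by gcongr; exact hy.2) h5⟩ (by gcongr)
  have e2 := hg.integral_le_sum_Ico h6.le
  rw [intervalIntegral.integral_comp_mul_right _ hh.ne', smul_eq_mul, inv_mul_le_iff₀ hh] at e2
  -- The comparison `e2` uses left endpoints, but index `j` stands for coordinate `j + 1` and needs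
  -- right endpoints. The shift costs at most `2 * M` before scaling by `h`, and the two edge pieces
  -- cost `M * h` each: hence the factor `4`.
  have htel : ∑ j ∈ Finset.Ico p q, f (((j : ℝ) + 1) * h) =
      ∑ j ∈ Finset.Ico p q, f (j * h) + (f (q * h) - f (p * h)) := by
    have := Finset.sum_Ico_sub (fun j : ℕ => f (j * h)) h6.le
    rw [Finset.sum_sub_distrib] at this
    push_cast at this
    linarith
  rw [← intervalIntegral.integral_add_adjacent_intervals (hi1.trans hi2) hi3,
    ← intervalIntegral.integral_add_adjacent_intervals hi1 hi2, htel]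
  have b1 := abs_le.1 (hbd (p * h) ⟨h1, by linarith⟩)
  have b2 := abs_le.1 (hbd (q * h) ⟨by linarith, h5⟩)
  nlinarith

/-- The energy of the grid values of an antitone profile. -/
theorem grid_energy_le {s : ℝ → ℝ} {r : ℝ} (hr : 0 ≤ r) (hκ : 0 < κ) (hh : 0 < h)
    (h2 : 2 * h ≤ X - κ) (hs : AntitoneOn s (Set.Icc κ X)) (hs0 : 0 ≤ s X) :
    ∑ j ∈ gridIndices κ X h, h * ((((j : ℝ) + 1) * h) ^ r * s (((j : ℝ) + 1) * h)) ≤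
      (1 + h / κ) ^ r * ∫ x in κ..X, x ^ r * s x := by
  obtain ⟨h1, h3, h4, h5, h6⟩ := grid_endpoints hκ hh h2
  have hκX : κ < X := by linarith
  have hpos (x : ℝ) (hx : x ∈ Set.Icc κ X) : 0 ≤ s x := hs0.trans (hs hx ⟨hκX.le, le_rfl⟩ hx.2)
  have hii : IntervalIntegrable (fun x => x ^ r * s x) volume κ X := by
    refine IntervalIntegrable.continuousOn_mul ?_ ?_
    · refine AntitoneOn.intervalIntegrable ?_
      rwa [Set.uIcc_of_le hκX.le]
    · exact (Real.continuous_rpow_const hr).continuousOn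
  have hint (a b : ℝ) (ha : κ ≤ a) (hab : a ≤ b) (hb : b ≤ X) :
      IntervalIntegrable (fun x => x ^ r * s x) volume a b := by
    refine hii.mono_set ?_
    rw [Set.uIcc_of_le hab, Set.uIcc_of_le hκX.le]
    exact Set.Icc_subset_Icc ha hb
  -- On a cell `s` is smallest at the right endpoint, while the power there exceeds its value at `x`
  -- by a factor at most `(1 + h / κ) ^ r` because `x ≥ κ`.
  have hcell (j : ℕ) (hj : j ∈ gridIndices κ X h) :
      h * ((((j : ℝ) + 1) * h) ^ r * s (((j : ℝ) + 1) * h)) ≤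
        (1 + h / κ) ^ r * ∫ x in (j * h)..((j + 1 : ℕ) * h), x ^ r * s x := by
    obtain ⟨hj1, hj2⟩ := bounds_of_mem_gridIndices hκ hκX hh hj
    have hlt : (j : ℝ) * h ≤ ((j : ℝ) + 1) * h := by nlinarith
    rw [← intervalIntegral.integral_const_mul]
    push_cast
    have hc : ∫ _ in ((j : ℝ) * h)..(((j : ℝ) + 1) * h),
        (((j : ℝ) + 1) * h) ^ r * s (((j : ℝ) + 1) * h) =
          h * ((((j : ℝ) + 1) * h) ^ r * s (((j : ℝ) + 1) * h)) := by
      rw [intervalIntegral.integral_const, smul_eq_mul]; ring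
    rw [← hc]
    refine intervalIntegral.integral_mono_on hlt (by simp)
      ((hint _ _ hj1 hlt hj2).const_mul _) fun x hx => ?_
    have hxκ : κ ≤ x := hj1.trans hx.1
    have hx0 : 0 < x := hκ.trans_le hxκ
    have hsx := hs ⟨hxκ, hx.2.trans hj2⟩ ⟨hj1.trans hlt, hj2⟩ hx.2
    have hle : ((j : ℝ) + 1) * h ≤ (1 + h / κ) * x := by
      have : h ≤ h / κ * x := by
        calc h = h / κ * κ := by field_simp
          _ ≤ _ := by gcongr
      linarith [hx.1]
    calc (((j : ℝ) + 1) * h) ^ r * s (((j : ℝ) + 1) * h)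
        ≤ ((1 + h / κ) * x) ^ r * s x := by
          gcongr
          exact hpos _ ⟨hj1.trans hlt, hj2⟩
      _ = (1 + h / κ) ^ r * (x ^ r * s x) := by
          rw [Real.mul_rpow (by positivity) hx0.le, mul_assoc]
  refine (Finset.sum_le_sum hcell).trans ?_
  rw [← Finset.mul_sum, gridIndices,
    intervalIntegral.sum_integral_adjacent_intervals_Ico (a := fun j : ℕ => (j : ℝ) * h) h6.le]
  · gcongr
    refine intervalIntegral.integral_mono_interval h1 (by gcongr) h5 ?_ hii
    refine (ae_restrict_mem measurableSet_Ioc).mono fun x hx => ?_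
    exact mul_nonneg (Real.rpow_nonneg (hκ.le.trans hx.1.le) _) (hpos x ⟨hx.1.le, hx.2⟩)
  · intro j hj
    obtain ⟨hj1, hj2⟩ := bounds_of_mem_gridIndices hκ hκX hh (Finset.mem_Ico.2 hj)
    push_cast
    exact hint _ _ hj1 (by nlinarith) hj2

end Grid

/-! ### The lower bound for a profile, on the grid and in the limit -/

/-- Here `e` is the noise variance and `ν` the scale of the profile. Posterior variance increases
with the noise, so a lower bound `η` on `e / ν` is what is needed; shrinking the prior by `l ≤ 1`
loses at most the factor `l`. -/
theorem posterior_variance_ge {l ν s e η : ℝ} (hl0 : 0 < l) (hl : l ≤ 1) (hν : 0 < ν) (hs : 0 < s)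
    (hη : 0 ≤ η) (he : η * ν ≤ e) :
    ν * (l * (s * η / (s + η))) ≤ l * ν * s * e / (l * ν * s + e) := by
  have he0 : 0 ≤ e := (mul_nonneg hη hν.le).trans he
  have h1 : 0 < l * ν * s := by positivity
  have h3 : ν * (l * (s * η / (s + η))) = (ν * l * s * η) / (s + η) := by ring
  rw [h3, div_le_div_iff₀ (by positivity) (by positivity)]
  have h4 : η * (l * ν * s + e) ≤ e * (s + η) := by
    have : l * (η * ν) * s ≤ e * s := by
      have : l * (η * ν) ≤ e := by nlinarith [mul_nonneg hη hν.le]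
      exact mul_le_mul_of_nonneg_right this hs.le
    nlinarith
  calc ν * l * s * η * (l * ν * s + e) = l * ν * s * (η * (l * ν * s + e)) := by ring
    _ ≤ l * ν * s * (e * (s + η)) := by gcongr
    _ = _ := by ring

/-- The variance of the posterior mean decreases with the noise, so `η` is now an upper bound for `e
/ ν`. Separate bounds allow negligible noise, with lower bound zero. -/
theorem posterior_gain_ge {l ν s e η : ℝ} (hl0 : 0 < l) (hl : l ≤ 1) (hν : 0 < ν) (hs : 0 < s)
    (he0 : 0 < e) (he : e ≤ η * ν) :
    ν * l ^ 2 * (s ^ 2 / (s + η)) ≤ (l * ν * s) ^ 2 / (l * ν * s + e) := by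
  have hη : 0 < η := by
    by_contra! h
    nlinarith
  have h3 : ν * l ^ 2 * (s ^ 2 / (s + η)) = (l * ν * s) ^ 2 / (ν * (s + η)) := by
    field_simp
  rw [h3]
  gcongr
  nlinarith [mul_pos hν hs]

theorem profile_loss_mono {η x y : ℝ} (hη : 0 ≤ η) (hx : 0 < x) (hxy : x ≤ y) :
    x * η / (x + η) ≤ y * η / (y + η) := by
  rw [div_le_div_iff₀ (by positivity) (by linarith)]
  nlinarith [mul_nonneg hη hη, mul_nonneg (mul_nonneg hη hη) (sub_nonneg.2 hxy)]

theorem profile_gain_mono {η x y : ℝ} (hη : 0 ≤ η) (hx : 0 < x) (hxy : x ≤ y) :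
    x ^ 2 / (x + η) ≤ y ^ 2 / (y + η) := by
  have hy : 0 < y := hx.trans_le hxy
  rw [div_le_div_iff₀ (by positivity) (by positivity)]
  have h1 : 0 ≤ (y - x) * (x * y) := mul_nonneg (sub_nonneg.2 hxy) (by positivity)
  have h2 : x ^ 2 ≤ y ^ 2 := by gcongr
  nlinarith

theorem weight_sq (m : ℝ) (j : ℕ) : weight m j ^ 2 = ((j : ℝ) + 1) ^ (2 * m) := by
  rw [weight, ← Real.rpow_natCast, ← Real.rpow_mul (by positivity), mul_comm]
  norm_num

set_option maxHeartbeats 1000000 in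
/-- The lower bound on the grid of mesh `h`, before passing to the limit. -/
theorem minimaxRisk_ge_grid {m c κ X ηl ηh D τ δ : ℝ} {s : ℝ → ℝ} (hm : 0 < m) (hc : 0 < c)
    (hκ : 0 < κ) (hs : AntitoneOn s (Set.Icc κ X)) (hsX : 0 < s X)
    (henergy : ∫ x in κ..X, x ^ (2 * m) * s x ≤ c ^ 2 / Real.pi ^ (2 * m))
    (hηl : 0 ≤ ηl) (hτ0 : 0 ≤ τ) (hτ1 : τ ≤ 1) (hδ : 0 < δ) (hδ1 : δ < 1)
    {h : ℝ} (hh : 0 < h) (h2 : 2 * h ≤ X - κ) (hslack : (1 - δ) * (1 + h / κ) ^ (2 * m) ≤ 1)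
    {ε b : ℝ} (hε : 0 < ε) (hεl : ηl * h ^ (2 * m + 1) ≤ ε ^ 2)
    (hεh : ε ^ 2 ≤ ηh * h ^ (2 * m + 1)) (hb : τ = 0 ∨ b * Real.log 2 * h ≤ D) :
    ENNReal.ofReal (h ^ (2 * m) *
      ((1 - δ) ^ 2 * ((∫ x in κ..X, s x * ηl / (s x + ηl)) -
          h * (4 * (|s κ * ηl / (s κ + ηl)| + |s X * ηl / (s X + ηl)|))) +
        τ * (((1 - δ) ^ 2) ^ 2 * ((gridIndices κ X h).card * h * Real.exp
          (((∫ x in κ..X, Real.log (s x ^ 2 / (s x + ηh))) -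
            h * (4 * (|Real.log (s κ ^ 2 / (s κ + ηh))| + |Real.log (s X ^ 2 / (s X + ηh))|)) -
            2 * D) / ((gridIndices κ X h).card * h)))) -
        h * (excessConst (c ^ 2 / Real.pi ^ (2 * m)) δ * sqVariance * κ ^ (-(2 * m)) *
          (X ^ (2 * m) * s κ * (c ^ 2 / Real.pi ^ (2 * m)))))) ≤ minimaxRisk m c ε b := by
  set C : ℝ := c ^ 2 / Real.pi ^ (2 * m) with hCdef
  have hC : 0 < C := by have := Real.pi_pos; positivity
  have hκX : κ < X := by linarith
  have hX : 0 < X := hκ.trans hκX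
  -- One factor `1 - δ` is the energy slack required by `minimaxRisk_ge`; the other absorbs the
  -- discretization factor `(1 + h / κ) ^ (2 * m)` through `hslack`.
  set l : ℝ := (1 - δ) ^ 2 with hl
  have hl0 : 0 < l := by have : 0 < 1 - δ := by linarith
                         positivity
  have hl1 : l ≤ 1 := by rw [hl]; nlinarith
  -- With this scale the weights `(x / h) ^ (2 * m)` turn the prior energy into a Riemann sum, and
  -- the risk acquires the factor `h ^ (2 * m)`.
  set ν : ℝ := h ^ (2 * m + 1) with hν
  have hν0 : 0 < ν := by positivity
  have hνh : ν = h ^ (2 * m) * h := by rw [hν, Real.rpow_add hh, Real.rpow_one]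
  have hηh : 0 < ηh := by
    by_contra! hcon
    nlinarith [pow_pos hε 2]
  set I := gridIndices κ X h with hIdef
  have hI : I.Nonempty := gridIndices_nonempty hκ hh h2
  have hn0 : (0 : ℝ) < I.card := by exact_mod_cast hI.card_pos
  set x : ℕ → ℝ := fun j => ((j : ℝ) + 1) * h with hx
  have hxmem (j : ℕ) (hj : j ∈ I) : x j ∈ Set.Icc κ X := by
    obtain ⟨hj1, hj2⟩ := bounds_of_mem_gridIndices hκ hκX hh hj
    exact ⟨by simp only [hx]; nlinarith, hj2⟩
  have hspos (y : ℝ) (hy : y ∈ Set.Icc κ X) : 0 < s y := hsX.trans_le (hs hy ⟨hκX.le, le_rfl⟩ hy.2)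
  set sd : ℕ → ℝ := fun j => if j ∈ I then √(l * ν * s (x j)) else 0 with hsd
  have hsdsq (j : ℕ) (hj : j ∈ I) : sd j ^ 2 = l * ν * s (x j) := by
    have := hspos _ (hxmem j hj)
    simp only [hsd, if_pos hj]
    exact Real.sq_sqrt (by positivity)
  have hw (j : ℕ) (hj : j ∈ I) :
      weight m j ^ 2 * sd j ^ 2 = l * (h * (x j ^ (2 * m) * s (x j))) := by
    rw [hsdsq j hj, weight_sq, hνh, hx, Real.mul_rpow (by positivity) hh.le]
    ring
  have hgrid := grid_energy_le (r := 2 * m) (by positivity) hκ hh h2 hs hsX.le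
  have hen : ∑ j ∈ I, weight m j ^ 2 * sd j ^ 2 ≤ (1 - δ) * C := by
    rw [Finset.sum_congr rfl hw, ← Finset.mul_sum]
    have hi0 : 0 ≤ (1 + h / κ) ^ (2 * m) := by positivity
    calc l * ∑ j ∈ I, h * (x j ^ (2 * m) * s (x j)) ≤ l * ((1 + h / κ) ^ (2 * m) * C) := by
          gcongr
          exact hgrid.trans (by gcongr)
      _ = (1 - δ) * ((1 - δ) * (1 + h / κ) ^ (2 * m)) * C := by rw [hl]; ring
      _ ≤ (1 - δ) * 1 * C := by
          have : 0 ≤ 1 - δ := by linarith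
          gcongr
      _ = _ := by ring
  have hP : 0 < (κ / h) ^ (2 * m) := by positivity
  have hPw (j : ℕ) (hj : j ∈ I) : (κ / h) ^ (2 * m) ≤ weight m j ^ 2 := by
    rw [weight_sq]
    gcongr
    rw [div_le_iff₀ hh]
    exact (hxmem j hj).1
  have hmain := minimaxRisk_ge hc hI (sd := sd) (b := b)
    (fun j hj => by
      simp only [hsd, if_pos hj]
      have := hspos _ (hxmem j hj)
      positivity)
    (fun j hj => by simp only [hsd, if_neg hj]) hε hδ hP hPw hen
  refine le_trans (ENNReal.ofReal_le_ofReal ?_) hmain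
  set K1 := 4 * (|s κ * ηl / (s κ + ηl)| + |s X * ηl / (s X + ηl)|) with hK1
  set K2 := 4 * (|Real.log (s κ ^ 2 / (s κ + ηh))| + |Real.log (s X ^ 2 / (s X + ηh))|) with hK2
  have hf1 : AntitoneOn (fun y => s y * ηl / (s y + ηl)) (Set.Icc κ X) := fun y hy z hz hyz =>
    profile_loss_mono hηl (hspos z hz) (hs hy hz hyz)
  have hf2 : AntitoneOn (fun y => Real.log (s y ^ 2 / (s y + ηh))) (Set.Icc κ X) :=
    fun y hy z hz hyz => by
      have := hspos z hz
      exact Real.log_le_log (by positivity) (profile_gain_mono hηh.le this (hs hy hz hyz))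
  have hR1 := integral_le_grid_sum hκ hh h2 hf1
  have hR2 := integral_le_grid_sum hκ hh h2 hf2
  rw [← hIdef, ← hK1] at hR1
  rw [← hIdef, ← hK2] at hR2
  have part1 : h ^ (2 * m) * (l * ((∫ x in κ..X, s x * ηl / (s x + ηl)) - h * K1)) ≤
      ∑ j ∈ I, sd j ^ 2 * ε ^ 2 / (sd j ^ 2 + ε ^ 2) := by
    calc h ^ (2 * m) * (l * ((∫ x in κ..X, s x * ηl / (s x + ηl)) - h * K1))
        ≤ h ^ (2 * m) * (l * (h * ∑ j ∈ I, s (x j) * ηl / (s (x j) + ηl))) := by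
          gcongr
          linarith
      _ = ∑ j ∈ I, ν * (l * (s (x j) * ηl / (s (x j) + ηl))) := by
          rw [← Finset.mul_sum, ← Finset.mul_sum, hνh]; ring
      _ ≤ _ := by
          refine Finset.sum_le_sum fun j hj => ?_
          rw [hsdsq j hj]
          exact posterior_variance_ge hl0 hl1 hν0 (hspos _ (hxmem j hj)) hηl hεl
  have part2 : h ^ (2 * m) * (τ * (l ^ 2 * (I.card * h * Real.exp
      (((∫ x in κ..X, Real.log (s x ^ 2 / (s x + ηh))) - h * K2 - 2 * D) / (I.card * h))))) ≤
      I.card * Real.exp ((∑ j ∈ I, Real.log ((sd j ^ 2) ^ 2 / (sd j ^ 2 + ε ^ 2)) -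
          2 * (b * Real.log 2)) / I.card) := by
    rcases hb with rfl | hb
    · rw [zero_mul, mul_zero]; positivity
    have hlog (j : ℕ) (hj : j ∈ I) : Real.log (ν * l ^ 2) + Real.log (s (x j) ^ 2 / (s (x j) + ηh))
        ≤ Real.log ((sd j ^ 2) ^ 2 / (sd j ^ 2 + ε ^ 2)) := by
      have hsj := hspos _ (hxmem j hj)
      rw [← Real.log_mul (by positivity) (by positivity), hsdsq j hj]
      exact Real.log_le_log (by positivity)
        (posterior_gain_ge hl0 hl1 hν0 hsj (pow_pos hε 2) hεh)
    have hsum := Finset.sum_le_sum hlog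
    rw [Finset.sum_add_distrib, Finset.sum_const, nsmul_eq_mul] at hsum
    calc _ ≤ h ^ (2 * m) * (1 * (l ^ 2 * (I.card * h * Real.exp
            (((∫ x in κ..X, Real.log (s x ^ 2 / (s x + ηh))) - h * K2 - 2 * D) /
              (I.card * h))))) := by gcongr
      _ = I.card * (Real.exp (Real.log (ν * l ^ 2)) * Real.exp
            (((∫ x in κ..X, Real.log (s x ^ 2 / (s x + ηh))) - h * K2 - 2 * D) /
              (I.card * h))) := by
          rw [Real.exp_log (by positivity), hνh]; ring
      _ ≤ _ := by
          rw [← Real.exp_add]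
          gcongr
          have e1 : (I.card * Real.log (ν * l ^ 2) +
              ∑ j ∈ I, Real.log (s (x j) ^ 2 / (s (x j) + ηh)) - 2 * (b * Real.log 2)) / I.card =
              Real.log (ν * l ^ 2) + (h * ∑ j ∈ I, Real.log (s (x j) ^ 2 / (s (x j) + ηh)) -
                2 * (b * Real.log 2 * h)) / (I.card * h) := by
            field_simp
            ring
          calc _ ≤ Real.log (ν * l ^ 2) + (h * ∑ j ∈ I, Real.log (s (x j) ^ 2 / (s (x j) + ηh)) -
                2 * (b * Real.log 2 * h)) / (I.card * h) := by
                gcongr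
                linarith
            _ = _ := e1.symm
            _ ≤ _ := by gcongr
  -- Every energy term is `O(h)` since `s ≤ s κ`, and they sum to at most `C`; so the sum of squares
  -- is `O(h)`, one order below the main terms.
  have part3 : excessConst C δ * sqVariance / (κ / h) ^ (2 * m) *
      ∑ j ∈ I, (weight m j ^ 2 * sd j ^ 2) ^ 2 ≤
      h ^ (2 * m) * (h * (excessConst C δ * sqVariance * κ ^ (-(2 * m)) *
          (X ^ (2 * m) * s κ * C))) := by
    have hmax (j : ℕ) (hj : j ∈ I) : weight m j ^ 2 * sd j ^ 2 ≤ h * (X ^ (2 * m) * s κ) := by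
      obtain ⟨hj1, hj2⟩ := hxmem j hj
      have hsj := hspos _ (hxmem j hj)
      rw [hw j hj]
      calc l * (h * (x j ^ (2 * m) * s (x j))) ≤ 1 * (h * (X ^ (2 * m) * s κ)) := by
            have h0 : 0 ≤ x j := hκ.le.trans hj1
            have := hs ⟨le_rfl, hκX.le⟩ (hxmem j hj) hj1
            gcongr
        _ = _ := one_mul _
    have hsq : ∑ j ∈ I, (weight m j ^ 2 * sd j ^ 2) ^ 2 ≤ h * (X ^ (2 * m) * s κ) * C := by
      have hsκ := hspos κ ⟨le_rfl, hκX.le⟩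
      calc ∑ j ∈ I, (weight m j ^ 2 * sd j ^ 2) ^ 2
          ≤ ∑ j ∈ I, h * (X ^ (2 * m) * s κ) * (weight m j ^ 2 * sd j ^ 2) := by
            refine Finset.sum_le_sum fun j hj => ?_
            rw [sq]
            exact mul_le_mul_of_nonneg_right (hmax j hj) (by positivity)
        _ = h * (X ^ (2 * m) * s κ) * ∑ j ∈ I, weight m j ^ 2 * sd j ^ 2 := by
            rw [Finset.mul_sum]
        _ ≤ h * (X ^ (2 * m) * s κ) * C := by
            gcongr
            exact hen.trans (by nlinarith)
    have hK := mul_nonneg (excessConst_nonneg hC hδ) sqVariance_nonneg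
    have hPinv : excessConst C δ * sqVariance / (κ / h) ^ (2 * m) =
        h ^ (2 * m) * (excessConst C δ * sqVariance * κ ^ (-(2 * m))) := by
      rw [Real.div_rpow hκ.le hh.le, Real.rpow_neg hκ.le]
      field_simp
    rw [hPinv]
    calc _ ≤ h ^ (2 * m) * (excessConst C δ * sqVariance * κ ^ (-(2 * m))) *
          (h * (X ^ (2 * m) * s κ) * C) := by gcongr
      _ = _ := by ring
  rw [mul_sub, mul_add]
  linarith

/-- The lower bound in the limit of small mesh `h`: the noise level satisfies
`ηl ≤ ε² / h ^ (2 m + 1) ≤ ηh`, and the budget in nats is at most `D / h` when `τ ≠ 0`. -/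
theorem eventually_minimaxRisk_ge {m c κ X ηl ηh D τ v : ℝ} {s : ℝ → ℝ} (hm : 0 < m) (hc : 0 < c)
    (hκ : 0 < κ) (hκX : κ < X) (hs : AntitoneOn s (Set.Icc κ X)) (hsX : 0 < s X)
    (henergy : ∫ x in κ..X, x ^ (2 * m) * s x ≤ c ^ 2 / Real.pi ^ (2 * m))
    (hηl : 0 ≤ ηl) (hτ0 : 0 ≤ τ) (hτ1 : τ ≤ 1)
    (hv : v < (∫ x in κ..X, s x * ηl / (s x + ηl)) + τ * ((X - κ) * Real.exp
      (((∫ x in κ..X, Real.log (s x ^ 2 / (s x + ηh))) - 2 * D) / (X - κ)))) :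
    ∀ᶠ h in 𝓝[>] (0 : ℝ), ∀ ε b : ℝ, 0 < ε → ηl * h ^ (2 * m + 1) ≤ ε ^ 2 →
      ε ^ 2 ≤ ηh * h ^ (2 * m + 1) → (τ = 0 ∨ b * Real.log 2 * h ≤ D) →
      ENNReal.ofReal (h ^ (2 * m) * v) ≤ minimaxRisk m c ε b := by
  set A1 := ∫ x in κ..X, s x * ηl / (s x + ηl)
  set F2 := ∫ x in κ..X, Real.log (s x ^ 2 / (s x + ηh))
  -- `δ` is fixed before `h` tends to zero: `excessConst` blows up as `δ → 0`, but for fixed `δ` the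
  -- correction vanishes with `h`.
  obtain ⟨δ, hδv, hδ, hδ1⟩ : ∃ δ : ℝ, v < (1 - δ) ^ 2 * A1 + τ * (((1 - δ) ^ 2) ^ 2 *
      ((X - κ) * Real.exp ((F2 - 2 * D) / (X - κ)))) ∧ 0 < δ ∧ δ < 1 := by
    have hlim : Tendsto (fun δ : ℝ => (1 - δ) ^ 2 * A1 + τ * (((1 - δ) ^ 2) ^ 2 *
        ((X - κ) * Real.exp ((F2 - 2 * D) / (X - κ))))) (𝓝[>] 0) (𝓝 ((1 - 0) ^ 2 * A1 +
          τ * (((1 - 0) ^ 2) ^ 2 * ((X - κ) * Real.exp ((F2 - 2 * D) / (X - κ)))))) :=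
      (Continuous.tendsto (by fun_prop) 0).mono_left nhdsWithin_le_nhds
    have h1 := hlim.eventually (lt_mem_nhds (a := v) (by simpa using hv))
    have h2 : ∀ᶠ δ in 𝓝[>] (0 : ℝ), δ ∈ Set.Ioo (0 : ℝ) 1 := Ioo_mem_nhdsGT one_pos
    obtain ⟨δ, hδ⟩ := (h1.and h2).exists
    exact ⟨δ, hδ.1, hδ.2.1, hδ.2.2⟩
  set K1 := 4 * (|s κ * ηl / (s κ + ηl)| + |s X * ηl / (s X + ηl)|) with hK1
  set K2 := 4 * (|Real.log (s κ ^ 2 / (s κ + ηh))| + |Real.log (s X ^ 2 / (s X + ηh))|) with hK2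
  set K3 := excessConst (c ^ 2 / Real.pi ^ (2 * m)) δ * sqVariance * κ ^ (-(2 * m)) *
          (X ^ (2 * m) * s κ * (c ^ 2 / Real.pi ^ (2 * m))) with hK3
  have hid : Tendsto (fun h : ℝ => h) (𝓝[>] 0) (𝓝 0) := nhdsWithin_le_nhds
  have hpos : ∀ᶠ h in 𝓝[>] (0 : ℝ), 0 < h := self_mem_nhdsWithin
  have hsmall : ∀ᶠ h in 𝓝[>] (0 : ℝ), 2 * h ≤ X - κ := by
    have hlim : Tendsto (fun h : ℝ => 2 * h) (𝓝[>] 0) (𝓝 (2 * 0)) := hid.const_mul 2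
    exact (hlim.eventually_lt_const (by linarith)).mono fun h hh => hh.le
  have hcard : Tendsto (fun h : ℝ => ((gridIndices κ X h).card : ℝ) * h) (𝓝[>] 0)
      (𝓝 (X - κ)) := by
    refine tendsto_of_tendsto_of_tendsto_of_le_of_le' (g := fun h => X - κ - 2 * h)
      (h := fun _ => X - κ) ?_ tendsto_const_nhds ?_ ?_
    · simpa using (tendsto_const_nhds (x := X - κ)).sub (hid.const_mul 2)
    · filter_upwards [hpos, hsmall] with h h1 h2 using (card_gridIndices hκ h1 h2).1
    · filter_upwards [hpos, hsmall] with h h1 h2 using (card_gridIndices hκ h1 h2).2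
  have hslack : ∀ᶠ h in 𝓝[>] (0 : ℝ), (1 - δ) * (1 + h / κ) ^ (2 * m) ≤ 1 := by
    have hlim : Tendsto (fun h : ℝ => (1 - δ) * (1 + h / κ) ^ (2 * m)) (𝓝[>] 0)
        (𝓝 ((1 - δ) * (1 + 0 / κ) ^ (2 * m))) :=
      (((hid.div_const κ).const_add 1).rpow_const (Or.inr (by positivity))).const_mul _
    exact (hlim.eventually_lt_const (by simpa using hδ)).mono fun h hh => hh.le
  have hfin : Tendsto (fun h : ℝ => (1 - δ) ^ 2 * (A1 - h * K1) + τ * (((1 - δ) ^ 2) ^ 2 *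
      ((gridIndices κ X h).card * h * Real.exp ((F2 - h * K2 - 2 * D) /
        ((gridIndices κ X h).card * h)))) - h * K3) (𝓝[>] 0) (𝓝 ((1 - δ) ^ 2 * (A1 - 0 * K1) +
      τ * (((1 - δ) ^ 2) ^ 2 * ((X - κ) * Real.exp ((F2 - 0 * K2 - 2 * D) / (X - κ)))) -
        0 * K3)) := by
    refine Tendsto.sub (Tendsto.add ?_ ?_) (hid.mul_const _)
    · exact ((hid.mul_const _).const_sub _).const_mul _
    · refine ((hcard.mul ((Real.continuous_exp.tendsto _).comp ?_)).const_mul _).const_mul _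
      exact (((hid.mul_const _).const_sub _).sub_const _).div hcard (by linarith)
  simp only [zero_mul, sub_zero] at hfin
  filter_upwards [hpos, hsmall, hslack, hfin.eventually (lt_mem_nhds hδv)]
    with h h1 h2 h3 h4 ε b hε hεl hεh hb
  refine le_trans (ENNReal.ofReal_le_ofReal ?_) (minimaxRisk_ge_grid hm hc hκ hs hsX henergy hηl
    hτ0 hτ1 hδ hδ1 h1 h2 h3 hε hεl hεh hb)
  gcongr

/-! ### Pinsker's profile and its integrals -/

/-- The right end of the support of Pinsker's profile. -/
def pinskerEdge (m c : ℝ) : ℝ :=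
  (c ^ 2 / Real.pi ^ (2 * m) * ((m + 1) * (2 * m + 1) / m)) ^ (1 / (2 * m + 1))

/-- Pinsker's profile, the least favourable `σ²` without a bit budget. -/
def pinskerProfile (m c x : ℝ) : ℝ := (pinskerEdge m c / x) ^ m - 1

section Pinsker

variable {m c : ℝ}

theorem pinskerEdge_pos (hm : 0 < m) (hc : 0 < c) : 0 < pinskerEdge m c := by
  have := Real.pi_pos; unfold pinskerEdge; positivity

theorem pinskerEdge_rpow (hm : 0 < m) (hc : 0 < c) : pinskerEdge m c ^ (2 * m + 1) =
    c ^ 2 / Real.pi ^ (2 * m) * ((m + 1) * (2 * m + 1) / m) := by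
  have := Real.pi_pos
  rw [pinskerEdge, ← Real.rpow_mul (by positivity), one_div_mul_cancel (by positivity),
    Real.rpow_one]

theorem pinskerConst_eq (hm : 0 < m) : pinskerConst m c = pinskerEdge m c * (m / (m + 1)) := by
  have := Real.pi_pos
  have hsplit : c ^ 2 / Real.pi ^ (2 * m) * ((m + 1) * (2 * m + 1) / m) =
      c ^ 2 * (2 * m + 1) / Real.pi ^ (2 * m) * (m / (m + 1))⁻¹ := by
    field_simp
  rw [pinskerConst, pinskerEdge, hsplit, Real.mul_rpow (by positivity) (by positivity), mul_assoc]
  congr 1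
  have h1 : 0 < m / (m + 1) := by positivity
  rw [Real.inv_rpow h1.le, ← Real.rpow_neg h1.le]
  nth_rw 3 [← Real.rpow_one (m / (m + 1))]
  rw [← Real.rpow_add h1]
  congr 1
  field_simp
  ring

theorem pinskerConst_pos (hm : 0 < m) (hc : 0 < c) : 0 < pinskerConst m c := by
  rw [pinskerConst_eq hm]
  have := pinskerEdge_pos hm hc
  positivity

theorem pinskerProfile_antitone (hm : 0 < m) (hc : 0 < c) :
    AntitoneOn (pinskerProfile m c) (Set.Ioi 0) := fun x hx y hy hxy => by
  have := pinskerEdge_pos hm hc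
  have hx : 0 < x := hx
  have hy : 0 < y := hy
  unfold pinskerProfile
  gcongr

theorem pinskerProfile_pos (hm : 0 < m) {x : ℝ} (hx : 0 < x)
    (hxe : x < pinskerEdge m c) : 0 < pinskerProfile m c x :=
  sub_pos.2 (Real.one_lt_rpow ((one_lt_div hx).2 hxe) hm)

theorem pinskerProfile_nonneg (hm : 0 < m) {x : ℝ} (hx : 0 < x)
    (hxe : x ≤ pinskerEdge m c) : 0 ≤ pinskerProfile m c x :=
  sub_nonneg.2 (Real.one_le_rpow ((one_le_div hx).2 hxe) hm.le)

/-- The profile is unbounded near `0`, but its loss is a function continuous up to `0`, which makes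
the integrals below elementary. -/
theorem pinskerProfile_loss (hm : 0 < m) (hc : 0 < c) {x : ℝ} (hx : 0 < x) :
    pinskerProfile m c x / (pinskerProfile m c x + 1) = 1 - (x / pinskerEdge m c) ^ m := by
  have h := pinskerEdge_pos hm hc
  rw [pinskerProfile, sub_add_cancel,
    show pinskerEdge m c / x = (x / pinskerEdge m c)⁻¹ from (inv_div _ _).symm,
    Real.inv_rpow (by positivity)]
  have : 0 < (x / pinskerEdge m c) ^ m := by positivity
  field_simp

theorem pinskerProfile_energy (hm : 0 < m) (hc : 0 < c) {x : ℝ} (hx : 0 < x) :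
    x ^ (2 * m) * pinskerProfile m c x = pinskerEdge m c ^ m * x ^ m - x ^ (2 * m) := by
  have h := pinskerEdge_pos hm hc
  rw [pinskerProfile, Real.div_rpow h.le hx.le, two_mul, Real.rpow_add hx]
  field_simp

theorem intervalIntegrable_pinskerProfile_energy (hm : 0 < m) (hc : 0 < c) {a b : ℝ} (ha : 0 ≤ a)
    (hab : a ≤ b) :
    IntervalIntegrable (fun x => x ^ (2 * m) * pinskerProfile m c x) volume a b := by
  have h : IntervalIntegrable (fun x => pinskerEdge m c ^ m * x ^ m - x ^ (2 * m)) volume a b := by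
    refine Continuous.intervalIntegrable ?_ _ _
    exact ((Real.continuous_rpow_const hm.le).const_mul _).sub
      (Real.continuous_rpow_const (by positivity))
  refine h.congr fun x hx => ?_
  rw [Set.uIoc_of_le hab] at hx
  exact (pinskerProfile_energy hm hc (ha.trans_lt hx.1)).symm

/-- This determines the edge `e`: the integral is `e ^ (2m+1) * (1/(m+1) - 1/(2m+1))`. -/
theorem integral_pinskerProfile_energy (hm : 0 < m) (hc : 0 < c) :
    ∫ x in (0 : ℝ)..pinskerEdge m c, x ^ (2 * m) * pinskerProfile m c x =
      c ^ 2 / Real.pi ^ (2 * m) := by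
  have h := pinskerEdge_pos hm hc
  have h1 : ∫ x in (0 : ℝ)..pinskerEdge m c, x ^ (2 * m) * pinskerProfile m c x =
      ∫ x in (0 : ℝ)..pinskerEdge m c, (pinskerEdge m c ^ m * x ^ m - x ^ (2 * m)) := by
    refine intervalIntegral.integral_congr_ae (ae_of_all _ fun x hx => ?_)
    rw [Set.uIoc_of_le h.le] at hx
    exact pinskerProfile_energy hm hc hx.1
  rw [h1, intervalIntegral.integral_sub, intervalIntegral.integral_const_mul,
    integral_rpow (Or.inl (by linarith)), integral_rpow (Or.inl (by linarith)),
    Real.zero_rpow (by positivity), Real.zero_rpow (by positivity), sub_zero, sub_zero,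
    mul_div_assoc', ← Real.rpow_add h, ← add_assoc, ← two_mul, pinskerEdge_rpow hm hc]
  · field_simp
    ring
  · exact ((Real.continuous_rpow_const hm.le).const_mul _).intervalIntegrable _ _
  · exact (Real.continuous_rpow_const (by positivity)).intervalIntegrable _ _

theorem continuous_pinsker_loss (hm : 0 < m) :
    Continuous fun x => 1 - (x / pinskerEdge m c) ^ m :=
  continuous_const.sub ((continuous_id.div_const _).rpow_const fun _ => Or.inr hm.le)

theorem integral_pinsker_loss (hm : 0 < m) (hc : 0 < c) :
    ∫ x in (0 : ℝ)..pinskerEdge m c, (1 - (x / pinskerEdge m c) ^ m) = pinskerConst m c := by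
  have h := pinskerEdge_pos hm hc
  rw [intervalIntegral.integral_comp_div (fun t => 1 - t ^ m) h.ne', zero_div, div_self h.ne',
    intervalIntegral.integral_sub (by simp), integral_rpow (Or.inl (by linarith)),
    pinskerConst_eq hm]
  · simp only [intervalIntegral.integral_const, smul_eq_mul]
    rw [Real.zero_rpow (by positivity), Real.one_rpow]
    field_simp
    ring
  · exact (Real.continuous_rpow_const hm.le).intervalIntegrable _ _

end Pinsker

/-! ### Limits inferior and the three regimes -/

theorem ofReal_le_of_forall_lt {V : ℝ} {L : ℝ≥0∞} (h : ∀ v < V, ENNReal.ofReal v ≤ L) :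
    ENNReal.ofReal V ≤ L := by
  have hlim : Tendsto ENNReal.ofReal (𝓝[<] V) (𝓝 (ENNReal.ofReal V)) :=
    (ENNReal.continuous_ofReal.tendsto V).mono_left nhdsWithin_le_nhds
  exact le_of_tendsto hlim (eventually_nhdsWithin_of_forall h)

/-- A scaled lower bound passes to the limit inferior. -/
theorem ofReal_le_liminf_mul {l : Filter ℝ} {R : ℝ → ℝ≥0∞} {f g : ℝ → ℝ} {V : ℝ}
    (hg : ∀ᶠ ε in l, 0 ≤ g ε) (hgf : ∀ᶠ ε in l, g ε * f ε = 1)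
    (h : ∀ v < V, ∀ᶠ ε in l, ENNReal.ofReal (f ε * v) ≤ R ε) :
    ENNReal.ofReal V ≤ liminf (fun ε => ENNReal.ofReal (g ε) * R ε) l := by
  refine ofReal_le_of_forall_lt fun v hv => le_liminf_of_le (by isBoundedDefault) ?_
  filter_upwards [hg, hgf, h v hv] with ε h1 h2 h3
  calc ENNReal.ofReal v = ENNReal.ofReal (g ε) * ENNReal.ofReal (f ε * v) := by
        rw [← ENNReal.ofReal_mul h1, ← mul_assoc, h2, one_mul]
    _ ≤ _ := by gcongr

theorem tendsto_mesh {m : ℝ} (hm : 0 < m) :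
    Tendsto (fun ε : ℝ => ε ^ (2 / (2 * m + 1))) (𝓝[>] 0) (𝓝[>] 0) := by
  refine tendsto_nhdsWithin_iff.2 ⟨?_, ?_⟩
  · have h : 0 < 2 / (2 * m + 1) := by positivity
    have := (Real.continuous_rpow_const h.le).tendsto 0
    rw [Real.zero_rpow h.ne'] at this
    exact this.mono_left nhdsWithin_le_nhds
  · filter_upwards [self_mem_nhdsWithin] with ε hε
    exact Real.rpow_pos_of_pos hε _

/-- At this mesh the noise variance is exactly `h ^ (2m+1)`, so the normalized noise level is `1` in
the first two regimes. -/
theorem mesh_rpow {m ε : ℝ} (hm : 0 < m) (hε : 0 < ε) :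
    (ε ^ (2 / (2 * m + 1))) ^ (2 * m + 1) = ε ^ 2 := by
  rw [← Real.rpow_mul hε.le, div_mul_cancel₀ _ (by positivity)]
  norm_num

theorem rate_mul_mesh {m ε : ℝ} (hε : 0 < ε) :
    ε ^ (-(4 * m) / (2 * m + 1)) * (ε ^ (2 / (2 * m + 1))) ^ (2 * m) = 1 := by
  rw [← Real.rpow_mul hε.le, ← Real.rpow_add hε]
  convert Real.rpow_zero ε using 2
  ring

theorem tendsto_integral_left {f : ℝ → ℝ} {X : ℝ} (hX : 0 < X)
    (hf : IntervalIntegrable f volume 0 X) :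
    Tendsto (fun κ => ∫ x in κ..X, f x) (𝓝[>] 0) (𝓝 (∫ x in (0 : ℝ)..X, f x)) := by
  have h := intervalIntegral.continuousOn_primitive_interval_left (a := 0) (b := X) (f := f)
    (μ := volume) (by
      rw [Set.uIcc_of_le hX.le]
      exact (intervalIntegrable_iff_integrableOn_Icc_of_le hX.le).1 hf)
  rw [Set.uIcc_of_le hX.le] at h
  have := (h 0 ⟨le_rfl, hX.le⟩).mono_left (nhdsWithin_mono 0 Set.Ioc_subset_Icc_self)
  rwa [nhdsWithin_Ioc_eq_nhdsGT hX] at this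

/-- Pinsker's lower bound, without any restriction on the number of bits. -/
theorem pinsker_le_liminf {m c : ℝ} (hm : 0 < m) (hc : 0 < c) (B : ℝ → ℝ) :
    ENNReal.ofReal (pinskerConst m c) ≤
      liminf (fun ε : ℝ => ENNReal.ofReal (ε ^ (-(4 * m) / (2 * m + 1))) *
        minimaxRisk m c ε (B ε)) (𝓝[>] 0) := by
  have hpos : ∀ᶠ ε in 𝓝[>] (0 : ℝ), 0 < ε := self_mem_nhdsWithin
  refine ofReal_le_liminf_mul (f := fun ε => (ε ^ (2 / (2 * m + 1))) ^ (2 * m))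
    (hpos.mono fun ε hε => Real.rpow_nonneg hε.le _)
    (hpos.mono fun ε hε => rate_mul_mesh hε) fun v hv => ?_
  set e := pinskerEdge m c with he
  have he0 : 0 < e := pinskerEdge_pos hm hc
  set G : ℝ → ℝ := fun x => 1 - (x / e) ^ m with hG
  have hGc : Continuous G := continuous_pinsker_loss hm
  -- The profile is cut at both ends: it blows up at `0`, and it vanishes at `e`, where a positive
  -- value is required.
  have hlim : Tendsto (fun κ : ℝ => (∫ x in (0 : ℝ)..(e - κ), G x) - ∫ x in (0 : ℝ)..κ, G x)
      (𝓝[>] 0) (𝓝 ((∫ x in (0 : ℝ)..(e - 0), G x) - ∫ x in (0 : ℝ)..0, G x)) := by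
    have hp : Continuous fun t : ℝ => ∫ x in (0 : ℝ)..t, G x :=
      intervalIntegral.continuous_primitive (fun a b => hGc.intervalIntegrable a b) 0
    exact (Continuous.tendsto (by fun_prop) 0).mono_left nhdsWithin_le_nhds
  rw [sub_zero, intervalIntegral.integral_same, sub_zero, integral_pinsker_loss hm hc] at hlim
  obtain ⟨κ, hκv, hκ0, hκe⟩ := ((hlim.eventually (lt_mem_nhds hv)).and
    (Ioo_mem_nhdsGT (show 0 < e / 2 by positivity))).exists
  have hκX : κ < e - κ := by linarith
  have hloss : ∫ x in κ..(e - κ), pinskerProfile m c x * 1 / (pinskerProfile m c x + 1) =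
      (∫ x in (0 : ℝ)..(e - κ), G x) - ∫ x in (0 : ℝ)..κ, G x := by
    rw [intervalIntegral.integral_interval_sub_left (hGc.intervalIntegrable _ _)
      (hGc.intervalIntegrable _ _)]
    refine intervalIntegral.integral_congr fun x hx => ?_
    rw [Set.uIcc_of_le hκX.le] at hx
    simp only [mul_one]
    exact pinskerProfile_loss hm hc (hκ0.trans_le hx.1)
  have hen : ∫ x in κ..(e - κ), x ^ (2 * m) * pinskerProfile m c x ≤
      c ^ 2 / Real.pi ^ (2 * m) := by
    rw [← integral_pinskerProfile_energy hm hc]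
    refine intervalIntegral.integral_mono_interval hκ0.le hκX.le (by linarith) ?_
      (intervalIntegrable_pinskerProfile_energy hm hc le_rfl he0.le)
    refine (ae_restrict_mem measurableSet_Ioc).mono fun x hx => ?_
    exact mul_nonneg (Real.rpow_nonneg hx.1.le _) (pinskerProfile_nonneg hm hx.1 hx.2)
  have hev := eventually_minimaxRisk_ge (ηl := 1) (ηh := 1) (D := 0) (τ := 0) (v := v) hm hc hκ0 hκX
    ((pinskerProfile_antitone hm hc).mono fun x hx => hκ0.trans_le hx.1)
    (pinskerProfile_pos hm (by linarith) (by linarith)) hen zero_le_one le_rfl zero_le_one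
    (by rw [hloss, zero_mul, add_zero]; exact hκv)
  filter_upwards [(tendsto_mesh hm).eventually hev, hpos] with ε h hε
  exact h ε (B ε) hε (by rw [mesh_rpow hm hε, one_mul]) (by rw [mesh_rpow hm hε, one_mul])
    (Or.inl rfl)

theorem intervalIntegrable_loss {s : ℝ → ℝ} {X : ℝ} (hX : 0 < X)
    (hs0 : ∀ x ∈ Set.Ioc 0 X, 0 ≤ s x) (hs : AntitoneOn s (Set.Ioc 0 X)) :
    IntervalIntegrable (fun x => s x / (s x + 1)) volume 0 X := by
  -- `s` may be unbounded near `0`, but `s / (s + 1)` stays below `1`; the value `1` at the origin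
  -- keeps the extension antitone on the closed interval.
  have hanti : AntitoneOn (fun x => if x ≤ 0 then 1 else s x / (s x + 1)) (Set.uIcc 0 X) := by
    rw [Set.uIcc_of_le hX.le]
    intro x hx y hy hxy
    by_cases hy0 : y ≤ 0
    · simp [hy0, hxy.trans hy0]
    have hy' : y ∈ Set.Ioc 0 X := ⟨not_le.1 hy0, hy.2⟩
    have h1 := hs0 y hy'
    by_cases hx0 : x ≤ 0
    · simp only [hx0, hy0, if_true, if_false]
      rw [div_le_one (by linarith)]
      linarith
    · have hx' : x ∈ Set.Ioc 0 X := ⟨not_le.1 hx0, hx.2⟩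
      have h2 := hs hx' hy' hxy
      simp only [hx0, hy0, if_false]
      rw [div_le_div_iff₀ (by linarith) (by linarith)]
      nlinarith
  refine hanti.intervalIntegrable.congr fun x hx => ?_
  rw [Set.uIoc_of_le hX.le] at hx
  simp [not_le.2 hx.1]

theorem Feasible.pos_right {m c d : ℝ} {s : ℝ → ℝ} {X : ℝ} (h : Feasible m c d s X) :
    0 < s X := by
  have hmem : X ∈ Set.Ioc 0 X := ⟨h.pos, le_rfl⟩
  refine lt_of_le_of_ne (h.nonneg X hmem) fun h0 => ?_
  have h1 := h.level_le X hmem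
  have h2 : 0 < waterLevel d s X := Real.exp_pos _
  rw [← h0, gain] at h1
  norm_num at h1
  linarith

theorem objective_le_liminf {m c d : ℝ} (hm : 0 < m) (hc : 0 < c) {B : ℝ → ℝ}
    (hB : ∀ ε : ℝ, 0 < ε → 0 ≤ B ε)
    (hBd : Tendsto (fun ε : ℝ => B ε * ε ^ (2 / (2 * m + 1))) (𝓝[>] 0) (𝓝 d))
    {s : ℝ → ℝ} {X : ℝ} (h : Feasible m c d s X) :
    ENNReal.ofReal (objective d s X) ≤
      liminf (fun ε : ℝ => ENNReal.ofReal (ε ^ (-(4 * m) / (2 * m + 1))) *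
        minimaxRisk m c ε (B ε)) (𝓝[>] 0) := by
  have hpos : ∀ᶠ ε in 𝓝[>] (0 : ℝ), 0 < ε := self_mem_nhdsWithin
  refine ofReal_le_liminf_mul (f := fun ε => (ε ^ (2 / (2 * m + 1))) ^ (2 * m))
    (hpos.mono fun ε hε => Real.rpow_nonneg hε.le _)
    (hpos.mono fun ε hε => rate_mul_mesh hε) fun v hv => ?_
  have hX := h.pos
  have hid : Tendsto (fun κ : ℝ => κ) (𝓝[>] 0) (𝓝 0) := nhdsWithin_le_nhds
  -- `κ` serves twice: as the left cutoff of the profile and as slack in the budget `d + κ`, since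
  -- the budget only converges to `d`.
  have hlim : Tendsto (fun κ => (∫ x in κ..X, s x / (s x + 1)) + (X - κ) * Real.exp
      (((∫ x in κ..X, Real.log (gain (s x))) - 2 * (d + κ)) / (X - κ))) (𝓝[>] 0)
      (𝓝 ((∫ x in (0 : ℝ)..X, s x / (s x + 1)) + (X - 0) * Real.exp
      (((∫ x in (0 : ℝ)..X, Real.log (gain (s x))) - 2 * (d + 0)) / (X - 0)))) := by
    refine (tendsto_integral_left hX (intervalIntegrable_loss hX h.nonneg h.decreasing)).add
      ((hid.const_sub X).mul ((Real.continuous_exp.tendsto _).comp ?_))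
    exact ((tendsto_integral_left hX h.log_integrable).sub ((hid.const_add d).const_mul 2)).div
      (hid.const_sub X) (by linarith)
  have hobj : objective d s X = (∫ x in (0 : ℝ)..X, s x / (s x + 1)) + (X - 0) * Real.exp
      (((∫ x in (0 : ℝ)..X, Real.log (gain (s x))) - 2 * (d + 0)) / (X - 0)) := by
    rw [objective, waterLevel, sub_zero, add_zero, sub_div, one_div, inv_mul_eq_div]
  rw [← hobj] at hlim
  obtain ⟨κ, hκv, hκ0, hκX⟩ := ((hlim.eventually (lt_mem_nhds hv)).and
    (Ioo_mem_nhdsGT hX)).exists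
  have hsub : Set.Icc κ X ⊆ Set.Ioc 0 X := fun x hx => ⟨hκ0.trans_le hx.1, hx.2⟩
  have hen : ∫ x in κ..X, x ^ (2 * m) * s x ≤ c ^ 2 / Real.pi ^ (2 * m) := by
    refine le_trans (intervalIntegral.integral_mono_interval hκ0.le hκX.le le_rfl ?_
      h.energy_integrable) h.energy_le
    refine (ae_restrict_mem measurableSet_Ioc).mono fun x hx => ?_
    exact mul_nonneg (Real.rpow_nonneg hx.1.le _) (h.nonneg x hx)
  have hev := eventually_minimaxRisk_ge (ηl := 1) (ηh := 1) (D := d + κ) (τ := 1) (v := v) hm hc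
    hκ0 hκX (h.decreasing.mono hsub) h.pos_right hen zero_le_one zero_le_one le_rfl
    (by simpa only [mul_one, one_mul, gain] using hκv)
  have hbud := hBd.eventually (gt_mem_nhds (show d < d + κ by linarith))
  filter_upwards [(tendsto_mesh hm).eventually hev, hpos, hbud] with ε h hε hb
  refine h ε (B ε) hε (by rw [mesh_rpow hm hε, one_mul]) (by rw [mesh_rpow hm hε, one_mul])
    (Or.inr ?_)
  -- A bit is worth `log 2` nats, while the water level charges a full nat per bit; the stated bound
  -- is weaker, and `log 2 ≤ 1` suffices.
  have hlog : Real.log 2 ≤ 1 := by linarith [Real.log_two_lt_d9]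
  have hlog0 : 0 ≤ Real.log 2 := Real.log_nonneg (by norm_num)
  have hBε := hB ε hε
  have hmesh : 0 ≤ ε ^ (2 / (2 * m + 1)) := Real.rpow_nonneg hε.le _
  calc B ε * Real.log 2 * ε ^ (2 / (2 * m + 1)) ≤ B ε * 1 * ε ^ (2 / (2 * m + 1)) := by gcongr
    _ ≤ d + κ := by rw [mul_one]; exact hb.le

theorem integral_powerProfile_energy {m a κ X : ℝ} (hκ : 0 < κ) (hκX : κ < X) :
    ∫ x in κ..X, x ^ (2 * m) * (a * x ^ (-(2 * m))) = a * (X - κ) := by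
  have : ∫ x in κ..X, x ^ (2 * m) * (a * x ^ (-(2 * m))) = ∫ _ in κ..X, a := by
    refine intervalIntegral.integral_congr fun x hx => ?_
    rw [Set.uIcc_of_le hκX.le] at hx
    have hx0 : 0 < x := hκ.trans_le hx.1
    simp only [Real.rpow_neg hx0.le]
    have : 0 < x ^ (2 * m) := by positivity
    field_simp
  rw [this, intervalIntegral.integral_const, smul_eq_mul, mul_comm]

/-- A lower bound for the mean log-gain of a power profile when the noise is a small fraction of its
smallest value. -/
theorem integral_log_powerProfile_ge {m a κ X μ : ℝ} (hm : 0 < m) (ha : 0 < a) (hκ : 0 < κ)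
    (hκX : κ < X) (hμ : 0 < μ) :
    (X - κ) * (Real.log a - μ) - 2 * m * ∫ x in κ..X, Real.log x ≤
      ∫ x in κ..X, Real.log ((a * x ^ (-(2 * m))) ^ 2 /
        (a * x ^ (-(2 * m)) + a * X ^ (-(2 * m)) * (Real.exp μ - 1))) := by
  have hX : 0 < X := hκ.trans hκX
  have hμ1 : 0 < Real.exp μ - 1 := by linarith [Real.add_one_lt_exp hμ.ne']
  have hlogi : IntervalIntegrable Real.log volume κ X :=
    intervalIntegral.intervalIntegrable_log'
  have hl : (X - κ) * (Real.log a - μ) - 2 * m * ∫ x in κ..X, Real.log x =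
      ∫ x in κ..X, (Real.log a - μ - 2 * m * Real.log x) := by
    rw [intervalIntegral.integral_sub (by simp) (hlogi.const_mul _),
      intervalIntegral.integral_const, intervalIntegral.integral_const_mul, smul_eq_mul]
  rw [hl]
  have hpow : ContinuousOn (fun x : ℝ => a * x ^ (-(2 * m))) (Set.uIcc κ X) := by
    rw [Set.uIcc_of_le hκX.le]
    exact continuousOn_const.mul (continuousOn_id.rpow_const fun x hx =>
      Or.inl (hκ.trans_le hx.1).ne')
  have hpos (x : ℝ) (hx : x ∈ Set.uIcc κ X) : 0 < a * x ^ (-(2 * m)) := by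
    rw [Set.uIcc_of_le hκX.le] at hx
    have := hκ.trans_le hx.1
    positivity
  have hden (x : ℝ) (hx : x ∈ Set.uIcc κ X) :
      0 < a * x ^ (-(2 * m)) + a * X ^ (-(2 * m)) * (Real.exp μ - 1) := by
    have := hpos x hx
    positivity
  refine intervalIntegral.integral_mono_on hκX.le ((by simp : IntervalIntegrable
    (fun _ => Real.log a - μ) volume κ X).sub (hlogi.const_mul _)) ?_ fun x hx => ?_
  · refine ContinuousOn.intervalIntegrable (ContinuousOn.log ((hpow.pow 2).div
      (hpow.add continuousOn_const) fun x hx => (hden x hx).ne') fun x hx => ?_)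
    have := hpos x hx
    have := hden x hx
    positivity
  · have hx0 : 0 < x := hκ.trans_le hx.1
    have hs : 0 < a * x ^ (-(2 * m)) := by positivity
    have hle : a * X ^ (-(2 * m)) ≤ a * x ^ (-(2 * m)) :=
      mul_le_mul_of_nonneg_left (Real.rpow_le_rpow_of_nonpos hx0 hx.2 (by linarith)) ha.le
    have e1 : Real.log a - μ - 2 * m * Real.log x =
        Real.log (a * x ^ (-(2 * m)) * Real.exp (-μ)) := by
      rw [Real.log_mul hs.ne' (Real.exp_pos _).ne', Real.log_exp, Real.log_mul ha.ne'
        (by positivity), Real.log_rpow hx0]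
      ring
    rw [e1]
    refine Real.log_le_log (by positivity) ?_
    rw [le_div_iff₀ (hden x (by rwa [Set.uIcc_of_le hκX.le]))]
    set s := a * x ^ (-(2 * m))
    calc s * Real.exp (-μ) * (s + a * X ^ (-(2 * m)) * (Real.exp μ - 1))
        ≤ s * Real.exp (-μ) * (s + s * (Real.exp μ - 1)) := by gcongr
      _ = s ^ 2 * (Real.exp (-μ) * Real.exp μ) := by ring
      _ = s ^ 2 := by rw [← Real.exp_add, neg_add_cancel, Real.exp_zero, mul_one]

/-- The lower bound when the budget is small compared with the effective dimension. -/
theorem low_rate_le_liminf {m c : ℝ} (hm : 0 < m) (hc : 0 < c) {B : ℝ → ℝ}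
    (hB0 : Tendsto (fun ε : ℝ => B ε * ε ^ (2 / (2 * m + 1))) (𝓝[>] 0) (𝓝 0))
    (hB : Tendsto B (𝓝[>] 0) atTop) :
    ENNReal.ofReal (c ^ 2 * m ^ (2 * m) / Real.pi ^ (2 * m)) ≤
      liminf (fun ε : ℝ => ENNReal.ofReal (B ε ^ (2 * m)) * minimaxRisk m c ε (B ε))
        (𝓝[>] 0) := by
  have hpos : ∀ᶠ ε in 𝓝[>] (0 : ℝ), 0 < ε := self_mem_nhdsWithin
  have hBpos : ∀ᶠ ε in 𝓝[>] (0 : ℝ), 0 < B ε := hB.eventually (eventually_gt_atTop 0)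
  refine ofReal_le_liminf_mul (f := fun ε => (B ε)⁻¹ ^ (2 * m))
    (hBpos.mono fun ε hε => Real.rpow_nonneg hε.le _)
    (hBpos.mono fun ε hε => by
      rw [Real.inv_rpow hε.le, mul_inv_cancel₀ (Real.rpow_pos_of_pos hε _).ne']) fun v hv => ?_
  set C : ℝ := c ^ 2 / Real.pi ^ (2 * m) with hCdef
  have hC : 0 < C := by have := Real.pi_pos; positivity
  -- With `D` nats per mesh unit the limiting value is `C * exp (-2m log X + 2m - 2D / X)`, maximal
  -- at `X = D / m`. Taking `D = 1` gives exactly `C * m ^ (2m)`; the actual `D = log 2` leaves the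
  -- slack `2m (1 - log 2)`.
  set X : ℝ := 1 / m with hXdef
  have hX : 0 < X := by positivity
  have hlog : Real.log 2 < 1 := by linarith [Real.log_two_lt_d9]
  have hid : Tendsto (fun κ : ℝ => κ) (𝓝[>] 0) (𝓝 0) := nhdsWithin_le_nhds
  have hlim : Tendsto (fun κ => C * Real.exp (-κ + (-(2 * m) * (∫ x in κ..X, Real.log x) -
      2 * Real.log 2) / (X - κ))) (𝓝[>] 0) (𝓝 (C * Real.exp (-0 + (-(2 * m) *
        (∫ x in (0 : ℝ)..X, Real.log x) - 2 * Real.log 2) / (X - 0)))) := by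
    refine ((Real.continuous_exp.tendsto _).comp (hid.neg.add ?_)).const_mul C
    exact (((tendsto_integral_left hX intervalIntegral.intervalIntegrable_log').const_mul
      _).sub_const _).div (hid.const_sub X) (by linarith)
  have hval : v < C * Real.exp (-0 + (-(2 * m) * (∫ x in (0 : ℝ)..X, Real.log x) -
      2 * Real.log 2) / (X - 0)) := by
    refine hv.trans ?_
    have hle : Real.log m * (2 * m) < -0 + (-(2 * m) * (∫ x in (0 : ℝ)..X, Real.log x) -
        2 * Real.log 2) / (X - 0) := by
      rw [integral_log, hXdef, Real.log_div one_ne_zero hm.ne', Real.log_one]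
      have : (-(2 * m) * (1 / m * (0 - Real.log m) - 0 * Real.log 0 - 1 / m + 0) -
          2 * Real.log 2) / (1 / m - 0) =
          Real.log m * (2 * m) + 2 * m * (1 - Real.log 2) := by
        field_simp
        ring
      rw [this]
      nlinarith
    calc c ^ 2 * m ^ (2 * m) / Real.pi ^ (2 * m) = C * Real.exp (Real.log m * (2 * m)) := by
          rw [Real.exp_mul, Real.exp_log hm, hCdef]; ring
      _ < _ := by gcongr
  obtain ⟨κ, hκv, hκ, hκX⟩ := ((hlim.eventually (lt_mem_nhds hval)).and
    (Ioo_mem_nhdsGT hX)).exists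
  set a : ℝ := C / (X - κ) with ha
  have hXκ : 0 < X - κ := by linarith
  have ha0 : 0 < a := by positivity
  have hexp1 : 0 < Real.exp κ - 1 := by linarith [Real.add_one_lt_exp hκ.ne']
  -- A noise level small against the least value of the profile; by `integral_log_powerProfile_ge`
  -- with `μ = κ` it lowers the mean log-gain by at most `κ`.
  set η : ℝ := a * X ^ (-(2 * m)) * (Real.exp κ - 1) with hη
  have hη0 : 0 < η := by positivity
  have hanti : AntitoneOn (fun x : ℝ => a * x ^ (-(2 * m))) (Set.Icc κ X) := by
    intro x hx y hy hxy
    exact mul_le_mul_of_nonneg_left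
      (Real.rpow_le_rpow_of_nonpos (hκ.trans_le hx.1) hxy (by linarith)) ha0.le
  have hlower := integral_log_powerProfile_ge (a := a) hm ha0 hκ hκX hκ
  rw [← hη] at hlower
  have hvlt : v < (X - κ) * Real.exp (((∫ x in κ..X, Real.log ((a * x ^ (-(2 * m))) ^ 2 /
      (a * x ^ (-(2 * m)) + η))) - 2 * Real.log 2) / (X - κ)) := by
    refine hκv.trans_le ?_
    have hCa : C = (X - κ) * Real.exp (Real.log a) := by
      rw [Real.exp_log ha0, ha]; field_simp
    rw [hCa, mul_assoc, ← Real.exp_add]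
    gcongr
    have : Real.log a + (-κ + (-(2 * m) * (∫ x in κ..X, Real.log x) - 2 * Real.log 2) / (X - κ)) =
        ((X - κ) * (Real.log a - κ) - 2 * m * (∫ x in κ..X, Real.log x) - 2 * Real.log 2) /
          (X - κ) := by
      field_simp
      ring
    rw [this]
    gcongr
  have hev := eventually_minimaxRisk_ge (ηl := 0) (ηh := η) (D := Real.log 2) (τ := 1) (v := v)
    hm hc hκ hκX hanti (by positivity)
    (by rw [integral_powerProfile_energy hκ hκX, ha]; exact (div_mul_cancel₀ C hXκ.ne').le)
    le_rfl zero_le_one le_rfl (by simpa only [mul_zero, zero_div,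
      intervalIntegral.integral_zero, zero_add, one_mul] using hvlt)
  have hmesh : Tendsto (fun ε => (B ε)⁻¹) (𝓝[>] 0) (𝓝[>] 0) := tendsto_inv_atTop_nhdsGT_zero.comp hB
  -- For mesh `1 / B` the normalized noise is `ε ^ 2 * B ^ (2m+1)`, a positive power of the
  -- vanishing ratio.
  have hnoise : ∀ᶠ ε in 𝓝[>] (0 : ℝ), (B ε * ε ^ (2 / (2 * m + 1))) ^ (2 * m + 1) < η := by
    have := hB0.rpow_const (p := 2 * m + 1) (Or.inr (by positivity))
    rw [Real.zero_rpow (by positivity)] at this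
    exact this.eventually (gt_mem_nhds hη0)
  filter_upwards [hmesh.eventually hev, hpos, hBpos, hnoise] with ε h hε hBε hn
  refine h ε (B ε) hε (by rw [zero_mul]; positivity) ?_ (Or.inr ?_)
  · rw [Real.mul_rpow hBε.le (Real.rpow_nonneg hε.le _), mesh_rpow hm hε] at hn
    rw [Real.inv_rpow hBε.le, ← div_eq_mul_inv, le_div_iff₀ (by positivity), mul_comm]
    exact hn.le
  · exact le_of_eq (by field_simp)

/-! ### Pinsker's constant does not exceed the variational value -/

theorem objective_le_variationalValue {m c d X : ℝ} {s : ℝ → ℝ} (h : Feasible m c d s X) :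
    ENNReal.ofReal (objective d s X) ≤ variationalValue m c d :=
  le_iSup_of_le s (le_iSup_of_le X (le_iSup_of_le h le_rfl))

theorem waterLevel_const {s X : ℝ} (hs : 0 < s) (hX : 0 < X) :
    waterLevel 0 (fun _ => s) X = gain s := by
  have hg : 0 < gain s := by unfold gain; positivity
  rw [waterLevel, intervalIntegral.integral_const, smul_eq_mul, sub_zero, mul_zero, zero_div,
    sub_zero, ← mul_assoc, one_div_mul_cancel hX.ne', one_mul, Real.exp_log hg]

/-- Posterior variance plus variance of the posterior mean is the prior variance: where the level
equals the gain, the objective counts plain mass. -/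
theorem div_add_gain {s : ℝ} (hs : 0 ≤ s) : s / (s + 1) + gain s = s := by
  unfold gain; field_simp; ring

/-- Without bits, constant profiles on short intervals reach Pinsker's constant. -/
theorem pinskerConst_le_variationalValue_zero {m c : ℝ} (hm : 0 < m) (hc : 0 < c) :
    ENNReal.ofReal (pinskerConst m c) ≤ variationalValue m c 0 := by
  have hπ := Real.pi_pos
  set P := pinskerConst m c with hPdef
  have hP : 0 < P := pinskerConst_pos hm hc
  set C : ℝ := c ^ 2 / Real.pi ^ (2 * m) with hCdef
  have hC : 0 < C := by positivity
  -- The height `P / X` gives mass `P`, and this `X` makes the energy `P * X ^ (2m) / (2m+1)` equal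
  -- to `C`.
  set X : ℝ := (C * (2 * m + 1) / P) ^ (1 / (2 * m)) with hX
  have hX0 : 0 < X := by positivity
  have hXpow : X ^ (2 * m) = C * (2 * m + 1) / P := by
    rw [hX, ← Real.rpow_mul (by positivity), one_div_mul_cancel (by positivity), Real.rpow_one]
  have hs : 0 < P / X := by positivity
  have hfeas : Feasible m c 0 (fun _ => P / X) X := by
    refine ⟨hX0, fun _ _ => hs.le, fun _ _ _ _ _ => le_rfl, ?_, ?_, by simp, fun _ _ =>
      (waterLevel_const hs hX0).le⟩
    · exact ((Real.continuous_rpow_const (by positivity)).mul_const _).intervalIntegrable _ _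
    · rw [intervalIntegral.integral_mul_const, integral_rpow (Or.inl (by linarith)),
        Real.zero_rpow (by positivity), sub_zero, Real.rpow_add hX0, hXpow, Real.rpow_one,
        ← hCdef]
      exact le_of_eq (by field_simp)
  refine le_trans (le_of_eq ?_) (objective_le_variationalValue hfeas)
  congr 1
  rw [objective, waterLevel_const hs hX0, intervalIntegral.integral_const, sub_zero, smul_eq_mul,
    ← mul_add, div_add_gain hs.le]
  field_simp

section Excess

variable {m c : ℝ}

theorem pinsker_ratio_lt_one (hm : 0 < m) {x : ℝ} (hx : 0 ≤ x) (hxe : x < pinskerEdge m c) :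
    (x / pinskerEdge m c) ^ m < 1 := by
  have he := hx.trans_lt hxe
  exact Real.rpow_lt_one (by positivity) ((div_lt_one he).2 hxe) hm

theorem log_gain_pinskerProfile (hm : 0 < m) {x : ℝ} (hx : 0 < x) (hxe : x < pinskerEdge m c) :
    Real.log (gain (pinskerProfile m c x)) =
      2 * Real.log (1 - (x / pinskerEdge m c) ^ m) + m * Real.log (pinskerEdge m c) -
        m * Real.log x := by
  have he := hx.trans hxe
  have hr := pinsker_ratio_lt_one hm hx.le hxe
  have hr0 : 0 < (x / pinskerEdge m c) ^ m := by positivity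
  have hg : gain (pinskerProfile m c x) =
      (1 - (x / pinskerEdge m c) ^ m) ^ 2 / (x / pinskerEdge m c) ^ m := by
    rw [gain, pinskerProfile,
      show pinskerEdge m c / x = (x / pinskerEdge m c)⁻¹ from (inv_div _ _).symm,
      Real.inv_rpow (by positivity)]
    field_simp
    ring
  rw [hg, Real.log_div (pow_ne_zero _ (by linarith)) hr0.ne', Real.log_pow,
    Real.log_rpow (by positivity), Real.log_div hx.ne' he.ne']
  push_cast
  ring

theorem continuousOn_log_one_sub_ratio (hm : 0 < m) {t : ℝ} (hte : t < pinskerEdge m c) :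
    ContinuousOn (fun x => Real.log (1 - (x / pinskerEdge m c) ^ m)) (Set.Icc 0 t) :=
  (continuous_pinsker_loss hm).continuousOn.log fun _ hx =>
    (sub_pos.2 (pinsker_ratio_lt_one hm hx.1 (hx.2.trans_lt hte))).ne'

theorem intervalIntegrable_log_gain_pinskerProfile (hm : 0 < m) {t : ℝ} (ht : 0 ≤ t)
    (hte : t < pinskerEdge m c) :
    IntervalIntegrable (fun x => Real.log (gain (pinskerProfile m c x))) volume 0 t := by
  have hψ : IntervalIntegrable (fun x => Real.log (1 - (x / pinskerEdge m c) ^ m)) volume 0 t := by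
    refine ContinuousOn.intervalIntegrable ?_
    rw [Set.uIcc_of_le ht]
    exact continuousOn_log_one_sub_ratio hm hte
  refine IntervalIntegrable.congr (f := fun x => 2 * Real.log (1 - (x / pinskerEdge m c) ^ m) +
    m * Real.log (pinskerEdge m c) - m * Real.log x) (fun x hx => ?_)
    (((hψ.const_mul 2).add (by simp)).sub
      (intervalIntegral.intervalIntegrable_log'.const_mul m))
  rw [Set.uIoc_of_le ht] at hx
  exact (log_gain_pinskerProfile hm hx.1 (hx.2.trans_lt hte)).symm

/-- The term `-m log x` integrates to `t` times its value at `t` plus `m * t`. The bracket is thus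
the excess of the log-gain over its endpoint value, to be matched with `2 * d`. -/
theorem integral_log_gain_pinskerProfile (hm : 0 < m) {t : ℝ} (ht : 0 < t)
    (hte : t < pinskerEdge m c) :
    ∫ x in (0 : ℝ)..t, Real.log (gain (pinskerProfile m c x)) =
      t * Real.log (gain (pinskerProfile m c t)) +
        ((∫ x in (0 : ℝ)..t, 2 * Real.log (1 - (x / pinskerEdge m c) ^ m)) -
          2 * t * Real.log (1 - (t / pinskerEdge m c) ^ m) + m * t) := by
  have hψ : IntervalIntegrable (fun x => 2 * Real.log (1 - (x / pinskerEdge m c) ^ m))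
      volume 0 t := by
    refine ContinuousOn.intervalIntegrable ?_
    rw [Set.uIcc_of_le ht.le]
    exact continuousOn_const.mul (continuousOn_log_one_sub_ratio hm hte)
  have h1 : ∫ x in (0 : ℝ)..t, Real.log (gain (pinskerProfile m c x)) =
      ∫ x in (0 : ℝ)..t, (2 * Real.log (1 - (x / pinskerEdge m c) ^ m) +
        m * Real.log (pinskerEdge m c) - m * Real.log x) := by
    refine intervalIntegral.integral_congr_ae (ae_of_all _ fun x hx => ?_)
    rw [Set.uIoc_of_le ht.le] at hx
    exact log_gain_pinskerProfile hm hx.1 (hx.2.trans_lt hte)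
  rw [h1, intervalIntegral.integral_sub (hψ.add (by simp))
    (intervalIntegral.intervalIntegrable_log'.const_mul m),
    intervalIntegral.integral_add hψ (by simp), intervalIntegral.integral_const,
    intervalIntegral.integral_const_mul m, integral_log, log_gain_pinskerProfile hm ht hte]
  simp only [smul_eq_mul, zero_mul]
  ring

/-- The point where the reverse water level for the budget `d` meets Pinsker's profile. -/
theorem exists_water_point (hm : 0 < m) (hc : 0 < c) {d : ℝ} (hd : 0 < d) :
    ∃ t, 0 < t ∧ t < pinskerEdge m c ∧
      ∫ x in (0 : ℝ)..t, Real.log (gain (pinskerProfile m c x)) =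
        t * Real.log (gain (pinskerProfile m c t)) + 2 * d := by
  set e := pinskerEdge m c with he
  have he0 : 0 < e := pinskerEdge_pos hm hc
  have h2m : (1 / 2 : ℝ) ^ m < 1 := Real.rpow_lt_one (by norm_num) (by norm_num) hm
  have h2m0 : 0 < (1 / 2 : ℝ) ^ m := by positivity
  -- Chosen so that `ψ T = ψ (e / 2) - 2 * d / e` for the `T` below. As `ψ` is antitone, `2 * (ψ - ψ
  -- T)` is at least `4 * d / e` on `[0, e / 2]`, hence `H T ≥ 2 * d` and the intermediate value
  -- theorem applies.
  set q : ℝ := (1 - (1 / 2 : ℝ) ^ m) * Real.exp (-(2 * d / e)) with hq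
  have hq0 : 0 < q := mul_pos (by linarith) (Real.exp_pos _)
  have hqle : q ≤ 1 - (1 / 2 : ℝ) ^ m := by
    have : Real.exp (-(2 * d / e)) ≤ 1 := Real.exp_le_one_iff.2 (by
      have : 0 < 2 * d / e := by positivity
      linarith)
    rw [hq]
    nlinarith
  set T : ℝ := e * (1 - q) ^ (1 / m) with hT
  have h1q : 0 < 1 - q := by linarith
  have hTr : (T / e) ^ m = 1 - q := by
    rw [hT, mul_div_cancel_left₀ _ he0.ne', ← Real.rpow_mul h1q.le, one_div_mul_cancel hm.ne',
      Real.rpow_one]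
  have hTe : T < e := by
    have : (1 - q) ^ (1 / m) < 1 := Real.rpow_lt_one h1q.le (by linarith) (by positivity)
    rw [hT]; nlinarith
  have hT2 : e / 2 ≤ T := by
    have : 1 / 2 ≤ (1 - q) ^ (1 / m) := by
      calc (1 / 2 : ℝ) = ((1 / 2 : ℝ) ^ m) ^ (1 / m) := by
            rw [← Real.rpow_mul (by norm_num), mul_one_div_cancel hm.ne', Real.rpow_one]
        _ ≤ _ := by gcongr; linarith
    rw [hT]; nlinarith
  have hT0 : 0 < T := by linarith
  set ψ : ℝ → ℝ := fun x => Real.log (1 - (x / e) ^ m) with hψ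
  have hψc : ContinuousOn ψ (Set.Icc 0 T) := continuousOn_log_one_sub_ratio hm hTe
  have hψi {a b : ℝ} (ha : 0 ≤ a) (hab : a ≤ b) (hb : b ≤ T) :
      IntervalIntegrable (fun x => 2 * ψ x) volume a b := by
    refine ContinuousOn.intervalIntegrable (continuousOn_const.mul (hψc.mono ?_))
    rw [Set.uIcc_of_le hab]
    exact Set.Icc_subset_Icc ha hb
  have hψanti {x y : ℝ} (hx : 0 ≤ x) (hxy : x ≤ y) (hy : y ≤ T) : ψ y ≤ ψ x := by
    have := pinsker_ratio_lt_one hm (hx.trans hxy) (hy.trans_lt hTe)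
    refine Real.log_le_log (by linarith) ?_
    gcongr
  set H : ℝ → ℝ := fun t => (∫ x in (0 : ℝ)..t, 2 * ψ x) - 2 * t * ψ t + m * t with hH
  have hHc : ContinuousOn H (Set.Icc 0 T) := by
    have h1 := intervalIntegral.continuousOn_primitive_interval' (a := 0) (hψi le_rfl hT0.le le_rfl)
      Set.left_mem_uIcc
    rw [Set.uIcc_of_le hT0.le] at h1
    exact (h1.sub ((continuousOn_const.mul continuousOn_id).mul hψc)).add
      (continuousOn_const.mul continuousOn_id)
  have hH0 : H 0 = 0 := by simp [hH]
  have hHT : 2 * d ≤ H T := by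
    have hψT : ψ T = Real.log (1 - (1 / 2 : ℝ) ^ m) - 2 * d / e := by
      simp only [hψ]
      rw [hTr, sub_sub_cancel, hq, Real.log_mul (by linarith) (Real.exp_pos _).ne', Real.log_exp]
      ring
    have hψhalf : ψ (e / 2) = Real.log (1 - (1 / 2 : ℝ) ^ m) := by
      simp only [hψ]
      congr 3
      field_simp
    have i1 : (∫ _ in (0 : ℝ)..(e / 2), 2 * ψ (e / 2)) ≤ ∫ x in (0 : ℝ)..(e / 2), 2 * ψ x :=
      intervalIntegral.integral_mono_on (by positivity) (by simp)
        (hψi le_rfl (by positivity) hT2) fun x hx => by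
          linarith [hψanti hx.1 hx.2 hT2]
    have i2 : (∫ _ in (e / 2)..T, 2 * ψ T) ≤ ∫ x in (e / 2)..T, 2 * ψ x :=
      intervalIntegral.integral_mono_on hT2 (by simp) (hψi (by positivity) hT2 le_rfl)
        fun x hx => by linarith [hψanti ((by positivity : 0 ≤ e / 2).trans hx.1) hx.2 le_rfl]
    rw [intervalIntegral.integral_const, smul_eq_mul] at i1 i2
    have hsplit := intervalIntegral.integral_add_adjacent_intervals
      (hψi le_rfl (by positivity : 0 ≤ e / 2) hT2) (hψi (by positivity) hT2 le_rfl)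
    have hde : e * (2 * d / e) = 2 * d := by field_simp
    have hmT : 0 < m * T := by positivity
    simp only [hH]
    rw [hψT] at i2 ⊢
    rw [hψhalf] at i1
    rw [← hsplit]
    nlinarith
  obtain ⟨t, ht, hHt⟩ := intermediate_value_Icc hT0.le hHc
    (show 2 * d ∈ Set.Icc (H 0) (H T) from ⟨by rw [hH0]; positivity, hHT⟩)
  have ht0 : 0 < t := by
    refine lt_of_le_of_ne ht.1 fun h0 => ?_
    rw [← h0, hH0] at hHt
    linarith
  have hte : t < e := ht.2.trans_lt hTe
  exact ⟨t, ht0, hte, by rw [integral_log_gain_pinskerProfile hm ht0 hte, ← hHt]⟩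

theorem continuousOn_pinskerProfile : ContinuousOn (pinskerProfile m c) (Set.Ioi 0) := by
  unfold pinskerProfile
  by_cases he : pinskerEdge m c = 0
  · simp only [he, zero_div]; exact continuousOn_const
  · exact ((continuousOn_const.div continuousOn_id fun x hx => ne_of_gt hx).rpow_const fun x hx =>
      Or.inl (div_ne_zero he (ne_of_gt hx))).sub continuousOn_const

/-- Replacing the tail of Pinsker's profile beyond `t` by a block of the same mass and of height
`σ²(t)` that starts at `t` does not increase the energy. -/
theorem block_energy_le (hm : 0 < m) (hc : 0 < c) {t x₁ : ℝ} (ht : 0 < t)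
    (hx₁ : t ≤ x₁) (hx₁e : x₁ ≤ pinskerEdge m c)
    (hmass : (x₁ - t) * pinskerProfile m c t = ∫ x in t..pinskerEdge m c, pinskerProfile m c x) :
    ∫ x in t..x₁, x ^ (2 * m) * pinskerProfile m c t ≤
      ∫ x in t..pinskerEdge m c, x ^ (2 * m) * pinskerProfile m c x := by
  set e := pinskerEdge m c
  have hsi {a b : ℝ} (ha : 0 < a) (hab : a ≤ b) :
      IntervalIntegrable (pinskerProfile m c) volume a b := by
    refine (continuousOn_pinskerProfile.mono fun x hx => ?_).intervalIntegrable
    rw [Set.uIcc_of_le hab] at hx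
    exact ha.trans_le hx.1
  have hei {a b : ℝ} (ha : 0 < a) (hab : a ≤ b) :
      IntervalIntegrable (fun x => x ^ (2 * m) * pinskerProfile m c x) volume a b :=
    intervalIntegrable_pinskerProfile_energy hm hc ha.le hab
  have hx₁0 : 0 < x₁ := ht.trans_le hx₁
  have hbi : IntervalIntegrable (fun x : ℝ => x ^ (2 * m) * pinskerProfile m c t) volume t x₁ :=
    ((Real.continuous_rpow_const (by positivity)).mul_const _).intervalIntegrable _ _
  -- Mass moves from beyond `x₁` to before it, so `x₁ ^ (2 * m)` bounds the weight from above where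
  -- mass is gained and from below where it is lost.
  have h1 : ∫ x in t..x₁, (x ^ (2 * m) * pinskerProfile m c t -
      x ^ (2 * m) * pinskerProfile m c x) ≤
      ∫ x in t..x₁, x₁ ^ (2 * m) * (pinskerProfile m c t - pinskerProfile m c x) := by
    refine intervalIntegral.integral_mono_on hx₁ (hbi.sub (hei ht hx₁))
      (((by simp : IntervalIntegrable (fun _ => pinskerProfile m c t) volume t x₁).sub
        (hsi ht hx₁)).const_mul _) fun x hx => ?_
    rw [← mul_sub]
    have hx0 : 0 < x := ht.trans_le hx.1
    have := pinskerProfile_antitone hm hc (Set.mem_Ioi.2 ht) (Set.mem_Ioi.2 hx0) hx.1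
    have hpow : x ^ (2 * m) ≤ x₁ ^ (2 * m) :=
      Real.rpow_le_rpow hx0.le hx.2 (by positivity)
    exact mul_le_mul_of_nonneg_right hpow (sub_nonneg.2 this)
  have h2 : ∫ x in x₁..e, x₁ ^ (2 * m) * pinskerProfile m c x ≤
      ∫ x in x₁..e, x ^ (2 * m) * pinskerProfile m c x := by
    refine intervalIntegral.integral_mono_on hx₁e ((hsi hx₁0 hx₁e).const_mul _)
      (hei hx₁0 hx₁e) fun x hx => ?_
    have hx0 : 0 < x := hx₁0.trans_le hx.1
    have hpow : x₁ ^ (2 * m) ≤ x ^ (2 * m) :=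
      Real.rpow_le_rpow hx₁0.le hx.1 (by positivity)
    exact mul_le_mul_of_nonneg_right hpow (pinskerProfile_nonneg hm hx0 hx.2)
  rw [intervalIntegral.integral_sub hbi (hei ht hx₁), intervalIntegral.integral_const_mul,
    intervalIntegral.integral_sub (by simp) (hsi ht hx₁), intervalIntegral.integral_const,
    smul_eq_mul, hmass, ← intervalIntegral.integral_add_adjacent_intervals (hsi ht hx₁)
    (hsi hx₁0 hx₁e), add_sub_cancel_left] at h1
  rw [intervalIntegral.integral_const_mul] at h2
  rw [← intervalIntegral.integral_add_adjacent_intervals (hei ht hx₁) (hei hx₁0 hx₁e)]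
  linarith

/-- Reverse water-filling applied to Pinsker's profile: the tail beyond the water point is flattened
to height `s₀`. On the block, loss and level add up to its full mass, which is the tail's mass `T`,
and `T` dominates the loss of the tail. -/
theorem pinskerConst_le_variationalValue_of_pos (hm : 0 < m) (hc : 0 < c) {d : ℝ} (hd : 0 < d) :
    ENNReal.ofReal (pinskerConst m c) ≤ variationalValue m c d := by
  obtain ⟨t, ht, hte, hlog⟩ := exists_water_point hm hc hd
  set e := pinskerEdge m c with he
  set s₀ := pinskerProfile m c t with hs₀
  have hs₀pos : 0 < s₀ := pinskerProfile_pos hm ht hte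
  set T := ∫ x in t..e, pinskerProfile m c x with hT
  set x₁ := t + T / s₀ with hx₁def
  have hsi : IntervalIntegrable (pinskerProfile m c) volume t e := by
    refine (continuousOn_pinskerProfile.mono fun x hx => ?_).intervalIntegrable
    rw [Set.uIcc_of_le hte.le] at hx
    exact ht.trans_le hx.1
  have hT0 : 0 ≤ T := intervalIntegral.integral_nonneg hte.le fun x hx =>
    pinskerProfile_nonneg hm (ht.trans_le hx.1) hx.2
  have hTle : T ≤ (e - t) * s₀ := by
    have := intervalIntegral.integral_mono_on hte.le hsi
      (by simp : IntervalIntegrable (fun _ => s₀) volume t e) fun x hx =>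
        pinskerProfile_antitone hm hc (Set.mem_Ioi.2 ht) (Set.mem_Ioi.2 (ht.trans_le hx.1)) hx.1
    rwa [intervalIntegral.integral_const, smul_eq_mul] at this
  have hx₁ : t ≤ x₁ := by
    have : 0 ≤ T / s₀ := div_nonneg hT0 hs₀pos.le
    linarith
  have hx₁e : x₁ ≤ e := by
    have : T / s₀ ≤ e - t := (div_le_iff₀ hs₀pos).2 hTle
    linarith
  have hx₁0 : 0 < x₁ := ht.trans_le hx₁
  have hmass : (x₁ - t) * s₀ = T := by rw [hx₁def]; field_simp; ring
  set s : ℝ → ℝ := fun x => pinskerProfile m c (min x t) with hs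
  have hsleft (F : ℝ → ℝ → ℝ) : Set.EqOn (fun x => F x (s x))
      (fun x => F x (pinskerProfile m c x)) (Set.uIoc 0 t) := fun x hx => by
    rw [Set.uIoc_of_le ht.le] at hx
    simp only [hs, min_eq_left hx.2]
  have hsright (F : ℝ → ℝ → ℝ) : Set.EqOn (fun x => F x (s x)) (fun x => F x s₀)
      (Set.uIoc t x₁) := fun x hx => by
    rw [Set.uIoc_of_le hx₁] at hx
    simp only [hs, min_eq_right hx.1.le, hs₀]
  have hsplit (F : ℝ → ℝ → ℝ)
      (h1 : IntervalIntegrable (fun x => F x (pinskerProfile m c x)) volume 0 t)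
      (h2 : IntervalIntegrable (fun x => F x s₀) volume t x₁) :
      IntervalIntegrable (fun x => F x (s x)) volume 0 x₁ ∧
      ∫ x in (0 : ℝ)..x₁, F x (s x) =
        (∫ x in (0 : ℝ)..t, F x (pinskerProfile m c x)) + ∫ x in t..x₁, F x s₀ := by
    have h1' := h1.congr (hsleft F).symm
    have h2' := h2.congr (hsright F).symm
    refine ⟨h1'.trans h2', ?_⟩
    rw [← intervalIntegral.integral_add_adjacent_intervals h1' h2']
    exact congrArg₂ (· + ·)
      (intervalIntegral.integral_congr_ae (ae_of_all _ fun x hx => hsleft F hx))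
      (intervalIntegral.integral_congr_ae (ae_of_all _ fun x hx => hsright F hx))
  have hGc := continuous_pinsker_loss (c := c) hm
  have hlossint : ∀ x ∈ Set.uIoc 0 t, 1 - (x / e) ^ m =
      pinskerProfile m c x / (pinskerProfile m c x + 1) := fun x hx => by
    rw [Set.uIoc_of_le ht.le] at hx
    exact (pinskerProfile_loss hm hc hx.1).symm
  obtain ⟨hen_int, hen_eq⟩ := hsplit (fun x y => x ^ (2 * m) * y)
    (intervalIntegrable_pinskerProfile_energy hm hc le_rfl ht.le)
    (((Real.continuous_rpow_const (by positivity)).mul_const _).intervalIntegrable _ _)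
  obtain ⟨hlog_int, hlog_eq⟩ := hsplit (fun _ y => Real.log (gain y))
    (intervalIntegrable_log_gain_pinskerProfile hm ht.le hte) (by simp)
  obtain ⟨-, hloss_eq⟩ := hsplit (fun _ y => y / (y + 1))
    ((hGc.intervalIntegrable 0 t).congr hlossint) (by simp)
  have hgain0 : 0 < gain s₀ := by unfold gain; positivity
  -- The block adds `(x₁ - t) * log (gain s₀)`, so the mean log-gain exceeds `log (gain s₀)` by
  -- exactly `2 * d / x₁`, for any block length.
  have hlevel : waterLevel d s x₁ = gain s₀ := by
    rw [waterLevel, hlog_eq, hlog, intervalIntegral.integral_const, smul_eq_mul,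
      show 1 / x₁ * (t * Real.log (gain s₀) + 2 * d + (x₁ - t) * Real.log (gain s₀)) - 2 * d / x₁ =
        Real.log (gain s₀) by field_simp; ring, Real.exp_log hgain0]
  have hsge (x : ℝ) (hx : x ∈ Set.Ioc 0 x₁) : s₀ ≤ s x :=
    pinskerProfile_antitone hm hc (Set.mem_Ioi.2 (lt_min hx.1 ht)) (Set.mem_Ioi.2 ht)
      (min_le_right _ _)
  have hfeas : Feasible m c d s x₁ := by
    refine ⟨hx₁0, fun x hx => hs₀pos.le.trans (hsge x hx), fun x hx y hy hxy => ?_, hen_int, ?_,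
      hlog_int, fun x hx => ?_⟩
    · exact pinskerProfile_antitone hm hc (Set.mem_Ioi.2 (lt_min hx.1 ht))
        (Set.mem_Ioi.2 (lt_min hy.1 ht)) (min_le_min_right t hxy)
    · have hblock := block_energy_le hm hc ht hx₁ hx₁e hmass
      have hC := integral_pinskerProfile_energy hm hc
      rw [← intervalIntegral.integral_add_adjacent_intervals
        (intervalIntegrable_pinskerProfile_energy hm hc le_rfl ht.le)
        (intervalIntegrable_pinskerProfile_energy hm hc ht.le hte.le)] at hC
      rw [hen_eq, ← hC]
      gcongr
    · rw [hlevel]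
      exact profile_gain_mono zero_le_one hs₀pos (hsge x hx)
  refine le_trans (ENNReal.ofReal_le_ofReal ?_) (objective_le_variationalValue hfeas)
  have hPle : ∫ x in t..e, (1 - (x / e) ^ m) ≤ T := by
    refine intervalIntegral.integral_mono_on hte.le (hGc.intervalIntegrable _ _) hsi fun x hx => ?_
    have hx0 : 0 < x := ht.trans_le hx.1
    have hp := pinskerProfile_nonneg hm hx0 hx.2
    rw [← pinskerProfile_loss hm hc hx0]
    exact div_le_self hp (by linarith)
  have hP := integral_pinsker_loss hm hc
  rw [← intervalIntegral.integral_add_adjacent_intervals (hGc.intervalIntegrable 0 t)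
    (hGc.intervalIntegrable t _)] at hP
  have hleft : ∫ x in (0 : ℝ)..t, pinskerProfile m c x / (pinskerProfile m c x + 1) =
      ∫ x in (0 : ℝ)..t, (1 - (x / e) ^ m) :=
    intervalIntegral.integral_congr_ae (ae_of_all _ fun x hx => (hlossint x hx).symm)
  rw [objective, hlevel, hloss_eq, hleft, intervalIntegral.integral_const, smul_eq_mul, ← hP]
  have hsum := div_add_gain hs₀pos.le
  have htg : 0 ≤ t * gain s₀ := by positivity
  -- The level also acts on `(0, t]`; that surplus `t * gain s₀` is nonnegative and is discarded.
  have : (x₁ - t) * (s₀ / (s₀ + 1)) + x₁ * gain s₀ = T + t * gain s₀ := by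
    rw [← hmass]
    linear_combination (x₁ - t) * hsum
  linarith

end Excess

theorem pinskerConst_le_variationalValue {m c d : ℝ} (hm : 0 < m) (hc : 0 < c) (hd : 0 ≤ d) :
    ENNReal.ofReal (pinskerConst m c) ≤ variationalValue m c d := by
  rcases hd.eq_or_lt with rfl | hd
  · exact pinskerConst_le_variationalValue_zero hm hc
  · exact pinskerConst_le_variationalValue_of_pos hm hc hd

end

end QuantizedSobolev

theorem theorem1 (m c : ℝ) (hm : 0 < m) (hc : 0 < c)
    (B : ℝ → ℝ) (hB : ∀ ε : ℝ, 0 < ε → 0 ≤ B ε) :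
    (Tendsto (fun ε : ℝ => B ε * ε ^ (2 / (2 * m + 1))) (𝓝[>] 0) atTop →
      ENNReal.ofReal (QuantizedSobolev.pinskerConst m c) ≤
        liminf (fun ε : ℝ => ENNReal.ofReal (ε ^ (-(4 * m) / (2 * m + 1))) *
          QuantizedSobolev.minimaxRisk m c ε (B ε)) (𝓝[>] 0)) ∧
    (∀ d : ℝ, Tendsto (fun ε : ℝ => B ε * ε ^ (2 / (2 * m + 1))) (𝓝[>] 0) (𝓝 d) →
      ENNReal.ofReal (QuantizedSobolev.pinskerConst m c) + QuantizedSobolev.quantConst m c d ≤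
        liminf (fun ε : ℝ => ENNReal.ofReal (ε ^ (-(4 * m) / (2 * m + 1))) *
          QuantizedSobolev.minimaxRisk m c ε (B ε)) (𝓝[>] 0) ∧
      ENNReal.ofReal (QuantizedSobolev.pinskerConst m c) + QuantizedSobolev.quantConst m c d =
        QuantizedSobolev.variationalValue m c d) ∧
    (Tendsto (fun ε : ℝ => B ε * ε ^ (2 / (2 * m + 1))) (𝓝[>] 0) (𝓝 0) →
      Tendsto B (𝓝[>] 0) atTop →
      ENNReal.ofReal (c ^ 2 * m ^ (2 * m) / Real.pi ^ (2 * m)) ≤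
        liminf (fun ε : ℝ => ENNReal.ofReal (B ε ^ (2 * m)) *
          QuantizedSobolev.minimaxRisk m c ε (B ε)) (𝓝[>] 0)) := by
  open QuantizedSobolev in
  refine ⟨fun _ => pinsker_le_liminf hm hc B, fun d hBd => ?_,
    fun hB0 hBtop => low_rate_le_liminf hm hc hB0 hBtop⟩
  -- A limit of nonnegative ratios; the sign of `d` is needed for `P ≤ V`, which makes the truncated
  -- subtraction in `quantConst` exact.
  have hd : 0 ≤ d := by
    refine ge_of_tendsto hBd ?_
    filter_upwards [self_mem_nhdsWithin] with ε hε
    exact mul_nonneg (hB ε hε) (Real.rpow_nonneg (le_of_lt hε) _)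
  have hV : ENNReal.ofReal (QuantizedSobolev.pinskerConst m c) +
      QuantizedSobolev.quantConst m c d = QuantizedSobolev.variationalValue m c d :=
    add_tsub_cancel_of_le (QuantizedSobolev.pinskerConst_le_variationalValue hm hc hd)
  refine ⟨?_, hV⟩
  rw [hV]
  exact iSup_le fun s => iSup_le fun X => iSup_le fun h =>
    QuantizedSobolev.objective_le_liminf hm hc hB hBd h
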